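/- Let $\mathbf A$ be a finite (nonempty) idempotent algebra, i.e. $f(x,\dots,x)=x$ for every basic operation $f$ of $\mathbf A$ and every $x\in A$. Let $x\vee y$ be a binary term in the language of $\mathbf A$ that is a pseudopartition operation on $\mathbf A$, i.e. $\mathbf A$ satisfies, for every basic operation $f$ (of arity $n$), the identities (P1) $x\vee x\approx x$, (P2) $(x\vee y)\vee z\approx x\vee(y\vee z)$, (P3) $x\vee(y\vee z)\approx x\vee(z\vee y)$, (P4) $y\vee f(x_1,\dots,x_n)\approx y\vee x_1\vee\cdots\vee x_n$. Let $\sigma=\{(a,b)\in A^2 : a\vee b=a \text{ and } b\vee a=b\}$ be the semilattice replica congruence of $\mathbf A$, whose blocks are subalgebras of $\mathbf A$. If there is a tractable variety $\mathcal V$ (of the similarity type of $\mathbf A$) such that every block of $\sigma$ lies in $\mathcal V$, then $\mathrm{CSP}(\mathbf A)$ is tractable. Here a finite algebra $\mathbf B$ is called tractable, and $\mathrm{CSP}(\mathbf B)$ is called tractable, if for every finite set $\Delta$ of finitary relations on $B$ that are invariant under all basic operations of $\mathbf B$, the decision problem $\mathrm{CSP}(\Delta)$ lies in $\mathbf P$.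 An instance of $\mathrm{CSP}(\Delta)$ consists of a finite set $V$ of variables and finitely many constraints $(S_i,R_i)$, where $R_i\in\Delta$ has arity $m_i$ and $S_i\in V^{m_i}$; the question is whether there is a map $g\colon V\to B$ with $g(S_i)\in R_i$ for all $i$. A variety is a class of algebras of one similarity type that is closed under homomorphic images, subalgebras and direct products; it is tractable if each of its finite members is tractable. -/

import Mathlib

universe u v w

namespace CSPAlg

open FirstOrder FirstOrder.Language.Structure

/-! ### Universal algebra

A similarity type is a first-order language `L` without relation symbols (`[L.IsAlgebraic]`), an
algebra of this type is a nonempty type with an `L.Structure`, and a term in the variables `α` is an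
element of `L.Term α`. -/

/-- The direct product of a family of algebras, with coordinatewise operations. -/
instance piStructure {L : FirstOrder.Language.{u, v}} {ι : Type*} (M : ι → Type*) [∀ i, L.Structure (M i)] :
    L.Structure (∀ i, M i) where
  funMap f x := fun i => funMap f (fun j => x j i)
  RelMap r x := ∀ i, RelMap r (fun j => x j i)

/-- An algebra is idempotent if each of its basic operations satisfies `f(x,…,x) ≈ x`. -/
def IsIdempotent (L : FirstOrder.Language.{u, v}) (A : Type w) [L.Structure A] : Prop :=
  ∀ (n : ℕ) (f : L.Functions n) (x : A), funMap f (fun _ => x) = x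

/-- A variety of algebras of similarity type `L`: a class of (nonempty) algebras closed under
homomorphic images, subalgebras and arbitrary direct products. -/
structure Variety (L : FirstOrder.Language.{u, v}) where
  Mem : ∀ (M : Type w) [L.Structure M] [Nonempty M], Prop
  image_mem : ∀ {M N : Type w} [L.Structure M] [Nonempty M] [L.Structure N] [Nonempty N]
    (f : M →[L] N), Function.Surjective f → Mem M → Mem N
  sub_mem : ∀ {M : Type w} [L.Structure M] [Nonempty M] (S : L.Substructure M) [Nonempty S],
    Mem M → Mem S
  pi_mem : ∀ {ι : Type w} (M : ι → Type w) [∀ i, L.Structure (M i)] [∀ i, Nonempty (M i)],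
    (∀ i, Mem (M i)) → Mem (∀ i, M i)

/-! ### Pseudopartition operations -/

section Pseudopartition

variable {L : FirstOrder.Language.{u, v}} {A : Type w} [L.Structure A]

/-- The binary operation `x ∨ y` on `A` given by the binary term `t`. -/
def join (t : L.Term (Fin 2)) (x y : A) : A := t.realize ![x, y]

variable (A) in
/-- The binary term `t`, written `x ∨ y`, is a pseudopartition operation on `A`. In the fourth
identity, `y ∨ x₁ ∨ ⋯ ∨ xₙ` is bracketed to the left (it is just `y` if `n = 0`). -/
structure IsPseudopartition (t : L.Term (Fin 2)) : Prop where
  /-- `x ∨ x ≈ x` -/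
  p1 : ∀ x : A, join t x x = x
  /-- `(x ∨ y) ∨ z ≈ x ∨ (y ∨ z)` -/
  p2 : ∀ x y z : A, join t (join t x y) z = join t x (join t y z)
  /-- `x ∨ (y ∨ z) ≈ x ∨ (z ∨ y)` -/
  p3 : ∀ x y z : A, join t x (join t y z) = join t x (join t z y)
  /-- `y ∨ f(x₁,…,xₙ) ≈ y ∨ x₁ ∨ ⋯ ∨ xₙ` for every basic operation `f` -/
  p4 : ∀ (n : ℕ) (f : L.Functions n) (y : A) (x : Fin n → A),
    join t y (funMap f x) = (List.ofFn x).foldl (join t) y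

/-- The semilattice replica congruence `σ = {(a, b) : a ∨ b = a and b ∨ a = b}`. -/
def SigmaRel (t : L.Term (Fin 2)) (a b : A) : Prop := join t a b = a ∧ join t b a = b

theorem foldl_join_eq {t : L.Term (Fin 2)} {a : A} :
    ∀ l : List A, (∀ x ∈ l, join t a x = a) → l.foldl (join t) a = a
  | [], _ => rfl
  | x :: l, h => by
    rw [List.foldl_cons, h x (by simp)]
    exact foldl_join_eq l fun y hy => h y (by simp [hy])

theorem foldl_join_join {t : L.Term (Fin 2)} (ht : IsPseudopartition A t) {a : A} :
    ∀ (l : List A) (y : A), l ≠ [] → (∀ x ∈ l, join t x a = x) →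
      join t (l.foldl (join t) y) a = l.foldl (join t) y
  | [], _, h, _ => absurd rfl h
  | [x], y, _, h => by simp [ht.p2, h x (by simp)]
  | x :: z :: l, y, _, h => by
    rw [List.foldl_cons]
    exact foldl_join_join ht (z :: l) _ (by simp) fun b hb => h b (by simp [hb])

/-- The block `a/σ` of the semilattice replica congruence, as a subalgebra of `A`. -/
def block (hA : IsIdempotent L A) {t : L.Term (Fin 2)} (ht : IsPseudopartition A t) (a : A) :
    L.Substructure A where
  carrier := {b | SigmaRel t b a}
  fun_mem := by
    intro n f x hx
    rcases Nat.eq_zero_or_pos n with rfl | hn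
    · have h : funMap f x = a := by
        rw [← hA 0 f a]; congr 1; exact Subsingleton.elim _ _
      exact ⟨by rw [h, ht.p1], by rw [h, ht.p1]⟩
    · refine ⟨?_, ?_⟩
      · have h1 := ht.p4 n f (funMap f x) x
        rw [ht.p1] at h1
        rw [h1]
        refine foldl_join_join ht _ _ ?_ ?_
        · simpa using hn.ne'
        · intro b hb
          obtain ⟨i, rfl⟩ := (List.mem_ofFn' x b).1 hb
          exact (hx i).1
      · rw [ht.p4]
        refine foldl_join_eq _ ?_
        intro b hb
        obtain ⟨i, rfl⟩ := (List.mem_ofFn' x b).1 hb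
        exact (hx i).2

instance block_nonempty (hA : IsIdempotent L A) {t : L.Term (Fin 2)} (ht : IsPseudopartition A t)
    (a : A) : Nonempty (block hA ht a) :=
  ⟨⟨a, ht.p1 a, ht.p1 a⟩⟩

end Pseudopartition

/-! ### Polynomial time -/

open Classical in
/-- The decision problem `p`, with instances written as binary strings by `enc`, lies in the class
`P`: some Turing machine, started on the code of an instance `a`, halts after a number of steps
bounded by a polynomial in the length of that code and outputs whether `p a` holds. -/
def InP {α : Type} (enc : α → List Bool) (p : α → Prop) : Prop :=
  Nonempty (Turing.TM2ComputableInPolyTime enc Computability.encodeBool fun a => decide (p a))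

/-! ### The constraint satisfaction problem -/

/-- A finitary relation on `A`. -/
structure FinitaryRel (A : Type w) where
  arity : ℕ
  rel : Set (Fin arity → A)

/-- An instance of `CSP(Δ)`, for a finite list `Δ` of `k` relations of arities `ar`. The variables
are `0, …, numVars - 1`, and a constraint consists of (the index of) a relation from `Δ` and a tuple
of variables of the appropriate length. -/
structure Instance {k : ℕ} (ar : Fin k → ℕ) where
  numVars : ℕ
  constraints : List (Σ i : Fin k, (Fin (ar i) → Fin numVars))

/-- The instance has a solution: a map from the variables to `A` which sends the scope of each
constraint into the constraint relation. -/
def Instance.Solvable {A : Type w} {k : ℕ} (Δ : Fin k → FinitaryRel A)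
    (I : Instance fun i => (Δ i).arity) : Prop :=
  ∃ g : Fin I.numVars → A, ∀ c ∈ I.constraints, (fun j => g (c.2 j)) ∈ (Δ c.1).rel

/-- The self-delimiting code `1ᵐ0` of a natural number `m`. -/
def encodeNat (m : ℕ) : List Bool := List.replicate m true ++ [false]

/-- The code of a constraint: the relation, followed by the variables of the scope. -/
def encodeConstraint {k : ℕ} {ar : Fin k → ℕ} {n : ℕ} (c : Σ i : Fin k, (Fin (ar i) → Fin n)) :
    List Bool :=
  encodeNat c.1 ++ (List.ofFn c.2).flatMap fun x : Fin n => encodeNat x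

/-- The binary string that encodes an instance: the number of variables, followed by the
constraints, each of them announced by a `1`, followed by a final `0`. All numbers are in unary;
since the variables are the numbers below `numVars` and the relations form a fixed finite list, the
length is polynomially related to the number of variables plus the number of constraints. -/
def Instance.encode {k : ℕ} {ar : Fin k → ℕ} (I : Instance ar) : List Bool :=
  encodeNat I.numVars ++ (I.constraints.flatMap fun c => true :: encodeConstraint c) ++ [false]

theorem encodeNat_append_inj : ∀ {m n : ℕ} {l l' : List Bool},
    encodeNat m ++ l = encodeNat n ++ l' → m = n ∧ l = l'
  | 0, 0, _, _, h => by simpa [encodeNat] using h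
  | 0, n + 1, _, _, h => by simp [encodeNat, List.replicate_succ] at h
  | m + 1, 0, _, _, h => by simp [encodeNat, List.replicate_succ] at h
  | m + 1, n + 1, l, l', h => by
    have := @encodeNat_append_inj m n l l' (by simpa [encodeNat, List.replicate_succ] using h)
    exact ⟨by rw [this.1], this.2⟩

theorem encodeScope_append_inj {n : ℕ} : ∀ {m : ℕ} {x y : Fin m → Fin n} {l l' : List Bool},
    ((List.ofFn x).flatMap fun i : Fin n => encodeNat i) ++ l =
      ((List.ofFn y).flatMap fun i : Fin n => encodeNat i) ++ l' → x = y ∧ l = l'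
  | 0, x, y, l, l', h => ⟨Subsingleton.elim _ _, by simpa using h⟩
  | m + 1, x, y, l, l', h => by
    simp only [List.ofFn_succ, List.flatMap_cons, List.append_assoc] at h
    obtain ⟨h0, h1⟩ := encodeNat_append_inj h
    obtain ⟨h2, h3⟩ := encodeScope_append_inj h1
    refine ⟨funext fun i => ?_, h3⟩
    induction i using Fin.cases with
    | zero => exact Fin.ext h0
    | succ i => exact congrFun h2 i

theorem encodeConstraints_append_inj {k : ℕ} {ar : Fin k → ℕ} {n : ℕ} :
    ∀ {c d : List (Σ i : Fin k, (Fin (ar i) → Fin n))},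
      (c.flatMap fun c => true :: encodeConstraint c) ++ [false] =
        (d.flatMap fun c => true :: encodeConstraint c) ++ [false] → c = d
  | [], [], _ => rfl
  | [], _ :: _, h => by simp at h
  | _ :: _, [], h => by simp at h
  | ⟨i, x⟩ :: c, ⟨j, y⟩ :: d, h => by
    simp only [List.flatMap_cons, encodeConstraint, List.cons_append, List.append_assoc,
      List.cons.injEq, true_and] at h
    obtain ⟨h0, h1⟩ := encodeNat_append_inj h
    obtain rfl := Fin.ext h0
    obtain ⟨h2, h3⟩ := encodeScope_append_inj h1
    rw [h2, encodeConstraints_append_inj h3]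

/-- Different instances have different codes. -/
theorem Instance.encode_injective {k : ℕ} {ar : Fin k → ℕ} :
    Function.Injective (Instance.encode (ar := ar)) := by
  rintro ⟨m, c⟩ ⟨n, d⟩ h
  simp only [Instance.encode, List.append_assoc] at h
  obtain ⟨h0, h1⟩ := encodeNat_append_inj h
  obtain rfl : m = n := h0
  rw [encodeConstraints_append_inj h1]

/-- A set `Γ` of finitary relations is tractable if `CSP(Δ)` is in `P` for every finite subset
`Δ = {Δ₀, …, Δ_{k-1}}` of `Γ`. -/
def IsTractable {A : Type w} (Γ : Set (FinitaryRel A)) : Prop :=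
  ∀ (k : ℕ) (Δ : Fin k → FinitaryRel A), (∀ i, Δ i ∈ Γ) → InP Instance.encode (Instance.Solvable Δ)

/-! ### Tractable algebras and varieties -/

/-- The relations on `A` that are invariant under all basic operations of the algebra `A`. -/
def Inv (L : FirstOrder.Language.{u, v}) (A : Type w) [L.Structure A] : Set (FinitaryRel A) :=
  {R | ∀ (n : ℕ) (f : L.Functions n) (x : Fin n → Fin R.arity → A), (∀ j, x j ∈ R.rel) →
    (fun i => funMap f fun j => x j i) ∈ R.rel}

/-- The algebra `A` is tractable, i.e. `CSP(A) = CSP(Inv A)` is tractable. -/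
def IsTractableAlgebra (L : FirstOrder.Language.{u, v}) (A : Type w) [L.Structure A] : Prop :=
  IsTractable (Inv L A)

/-- A variety is tractable if each of its finite members is tractable. -/
def Variety.IsTractable {L : FirstOrder.Language.{u, v}} (V : Variety.{u, v, w} L) : Prop :=
  ∀ (M : Type w) [L.Structure M] [Nonempty M] [Finite M], V.Mem M → IsTractableAlgebra L M

end CSPAlg

/-! Quasi-order `A` by `x ≤ y` iff `y ∨ x = y` (`JoinLE`). The induced equivalence is `σ`, and `y ∨
x` depends on `x` only through its block (`join_eq_join`).

Suppose that each variable `x` carries a value `M x` with `g x ≤ M x` for every solution `g`. For a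
constraint with scope `s` and relation `R`, let `y` be a join of all tuples of `R` below `M ∘ s`.
Invariance puts `y` into `R`, and `y` still bounds every solution, so `M` may be lowered to `y`
wherever `y` is strictly smaller. Once nothing can be lowered, `y` and `M ∘ s` agree modulo `σ`.
Hence `g ∘ s ∨ M ∘ s = g ∘ s ∨ y` is in `R`, so `g ∨ M` is again a solution (`join_solution`), and
it sends `x` into the block of `M x` (`sigmaRel_join`).

The instance is therefore solvable iff it has a solution with each `x` in the block of `M x`. To
have a single domain for all variables, take the product of all blocks and let a constraint read
only the coordinate `M x` of the value of `x` (`blockRel`). This product is a finite member of the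
tractable variety. Only finitely many relations arise: one for each relation of `Δ` and each choice
of bounds for its positions.

Each lowering shrinks the set of elements below `M x` (`card_joinLE_lt`), so there are only linearly
many rounds. Membership in `P` refers to Turing machines, so the reduction is carried out by an
explicit stack machine (`InP.of_propagator`), which is composed with the machine deciding the target
problem (`InP.of_stackTransducer`). -/

namespace CSPAlg

open Turing

/-! ### Stack transducers -/

/-- A machine with finitely many stacks and finitely many states. In the state `q` it pops a symbol
from the stack `src q`; depending on this symbol it pushes some symbols, writes at most one bit to
the left end of its output and changes the state, or stops. -/
structure StackTransducer where
  {K : Type}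
  [decEqK : DecidableEq K]
  [fintypeK : Fintype K]
  (Γ : K → Type)
  [fintypeΓ : ∀ k, Fintype (Γ k)]
  {Q : Type}
  [fintypeQ : Fintype Q]
  (input : K)
  (inputEquiv : Γ input ≃ Bool)
  (start : Q)
  (src : Q → K)
  (act : ∀ q, Option (Γ (src q)) → List (Σ k, Γ k) × Option Bool × Option Q)

namespace StackTransducer

attribute [instance] decEqK fintypeK fintypeΓ fintypeQ

variable (M : StackTransducer)

/-- Push a list of symbols, the head first. -/
def pushAll : List (Σ k, M.Γ k) → (∀ k, List (M.Γ k)) → ∀ k, List (M.Γ k)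
  | [], S => S
  | p :: l, S => pushAll l (Function.update S p.1 (p.2 :: S p.1))

/-- The state (`none` after the machine has stopped), the stacks and the output. -/
@[ext]
structure Cfg where
  state : Option M.Q
  stk : ∀ k, List (M.Γ k)
  out : List Bool

/-- One step in the state `q`. -/
def next (q : M.Q) (S : ∀ k, List (M.Γ k)) (o : List Bool) : M.Cfg :=
  ⟨(M.act q (S (M.src q)).head?).2.2,
    M.pushAll (M.act q (S (M.src q)).head?).1 (Function.update S (M.src q) (S (M.src q)).tail),
    (M.act q (S (M.src q)).head?).2.1.toList ++ o⟩

/-- `c'` is reached from `c` in at most `t` steps. -/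
inductive Reach : ℕ → M.Cfg → M.Cfg → Prop
  | refl (t : ℕ) (c : M.Cfg) : Reach t c c
  | head {t : ℕ} {q : M.Q} {S : ∀ k, List (M.Γ k)} {o : List Bool} {c : M.Cfg} :
      Reach t (M.next q S o) c → Reach (t + 1) ⟨some q, S, o⟩ c

variable {M}

theorem Reach.mono {s t : ℕ} {c c' : M.Cfg} (h : M.Reach s c c') (hst : s ≤ t) :
    M.Reach t c c' := by
  induction h generalizing t with
  | refl => exact .refl _ _
  | head _ ih =>
    obtain ⟨t, rfl⟩ : ∃ t', t = t' + 1 := ⟨t - 1, by omega⟩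
    exact .head (ih (by omega))

theorem Reach.trans {s t : ℕ} {c c' c'' : M.Cfg} (h : M.Reach s c c') (h' : M.Reach t c' c'') :
    M.Reach (s + t) c c'' := by
  induction h with
  | refl => exact h'.mono (by omega)
  | head _ ih => exact (Reach.head (ih h')).mono (by omega)

/-- A step writes at most one bit. The running time of the transducer thus also bounds the input
length of the machine that is run afterwards. -/
theorem Reach.length_out_le {t : ℕ} {c c' : M.Cfg} (h : M.Reach t c c') :
    c'.out.length ≤ c.out.length + t := by
  induction h with
  | refl => simp
  | @head t q S o c _ ih =>
    have : (M.next q S o).out.length ≤ o.length + 1 := by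
      simp only [next, List.length_append]
      cases (M.act q (S (M.src q)).head?).2.1 <;> simp; omega
    simp only
    omega

/-- The configuration in which the machine starts on the input `x`. -/
def initCfg (M : StackTransducer) (x : List Bool) : M.Cfg :=
  ⟨some M.start, Function.update (fun _ => []) M.input (x.map M.inputEquiv.symm), []⟩

/-- The configuration in which all stacks are empty and the output `y` has been written. -/
def doneCfg (M : StackTransducer) (y : List Bool) : M.Cfg :=
  ⟨none, fun _ => [], y⟩

end StackTransducer

/-! ### Running a Turing machine on the output of a stack transducer -/

/-- The stacks when the Turing machine starts on the input `s`. -/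
def inputStk (tm : FinTM2) (s : List (tm.Γ tm.k₀)) : ∀ k, List (tm.Γ k) :=
  Function.update (fun _ => []) tm.k₀ s

theorem initList_stk (tm : FinTM2) (s : List (tm.Γ tm.k₀)) :
    (initList tm s).stk = inputStk tm s := by
  rw [inputStk]
  funext k
  by_cases h : k = tm.k₀
  · subst h; simp [initList]
  · simp [initList, h]

theorem haltList_stk (tm : FinTM2) (s : List (tm.Γ tm.k₁)) :
    (haltList tm s).stk = Function.update (fun _ => []) tm.k₁ s := by
  funext k
  by_cases h : k = tm.k₁
  · subst h; simp [haltList]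
  · simp [haltList, h]

namespace StackTransducer

variable (M : StackTransducer) (tm : FinTM2)

/-- The stack alphabets of the composite machine. -/
abbrev compΓ : M.K ⊕ tm.K → Type := Sum.elim M.Γ tm.Γ

/-- The internal states of the composite machine: the symbol just popped by the transducer, and the
internal state of the Turing machine. -/
abbrev CompState : Type := Option (Σ k, M.Γ k) × tm.σ

/-- The statements of the composite machine. -/
abbrev CompStmt : Type := TM2.Stmt (M.compΓ tm) (M.Q ⊕ tm.Λ) (M.CompState tm)

/-- The stacks of the composite machine. -/
def compStk (S : ∀ k, List (M.Γ k)) (S' : ∀ k, List (tm.Γ k)) : ∀ k, List (M.compΓ tm k)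
  | .inl k => S k
  | .inr k => S' k

variable {M tm}

theorem update_compStk_inl (S : ∀ k, List (M.Γ k)) (S' : ∀ k, List (tm.Γ k)) (k : M.K)
    (l : List (M.Γ k)) :
    Function.update (M.compStk tm S S') (.inl k) l = M.compStk tm (Function.update S k l) S' := by
  funext j
  rcases j with j | j
  · by_cases h : j = k
    · subst h
      exact (Function.update_self ..).trans (Function.update_self j l S).symm
    · refine (Function.update_of_ne (by simpa) ..).trans ?_
      simp only [compStk, Function.update_of_ne h]
      rfl
  · exact Function.update_of_ne (by simp) ..

theorem update_compStk_inr (S : ∀ k, List (M.Γ k)) (S' : ∀ k, List (tm.Γ k)) (k : tm.K)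
    (l : List (tm.Γ k)) :
    Function.update (M.compStk tm S S') (.inr k) l = M.compStk tm S (Function.update S' k l) := by
  funext j
  rcases j with j | j
  · exact Function.update_of_ne (by simp) ..
  · by_cases h : j = k
    · subst h
      exact (Function.update_self ..).trans (Function.update_self j l S').symm
    · refine (Function.update_of_ne (by simpa) ..).trans ?_
      simp only [compStk, Function.update_of_ne h]
      rfl

/-- A statement of the Turing machine, as a statement of the composite machine. -/
def liftStmt : TM2.Stmt tm.Γ tm.Λ tm.σ → M.CompStmt tm
  | .push k f q => .push (.inr k) (fun s => f s.2) (liftStmt q)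
  | .peek k f q => .peek (.inr k) (fun s x => (s.1, f s.2 x)) (liftStmt q)
  | .pop k f q => .pop (.inr k) (fun s x => (s.1, f s.2 x)) (liftStmt q)
  | .load f q => .load (fun s => (s.1, f s.2)) (liftStmt q)
  | .branch p q q' => .branch (fun s => p s.2) (liftStmt q) (liftStmt q')
  | .goto l => .goto fun s => .inr (l s.2)
  | .halt => .halt

/-- A configuration of the Turing machine, as a configuration of the composite machine. -/
def liftCfg (c : TM2.Cfg tm.Γ tm.Λ tm.σ) : TM2.Cfg (M.compΓ tm) (M.Q ⊕ tm.Λ) (M.CompState tm) :=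
  ⟨c.l.map .inr, (none, c.var), M.compStk tm (fun _ => []) c.stk⟩

theorem stepAux_liftStmt (q : TM2.Stmt tm.Γ tm.Λ tm.σ) (s : tm.σ) (S : ∀ k, List (tm.Γ k)) :
    TM2.stepAux (liftStmt (M := M) q) (none, s) (M.compStk tm (fun _ => []) S) =
      liftCfg (TM2.stepAux q s S) := by
  induction q generalizing s S with
  | push k f q ih => simp only [liftStmt, TM2.stepAux]; erw [update_compStk_inr, ih]; rfl
  | peek k f q ih => simp only [liftStmt, TM2.stepAux]; erw [ih]; rfl
  | pop k f q ih => simp only [liftStmt, TM2.stepAux]; erw [update_compStk_inr, ih]; rfl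
  | load f q ih => simp only [liftStmt, TM2.stepAux]; rw [ih]
  | branch p q q' ih ih' =>
    simp only [liftStmt, TM2.stepAux]
    cases p s
    · exact ih' s S
    · exact ih s S
  | goto l => rfl
  | halt => rfl

/-- The statement which passes to the next state of the transducer, or starts the Turing machine. -/
def contStmt : Option M.Q → M.CompStmt tm
  | some q => .load (fun s => (none, s.2)) (.goto fun _ => .inl q)
  | none => .load (fun s => (none, s.2)) (.goto fun _ => .inr tm.main)

/-- The statement which writes the output of the transducer to the input stack of the Turing
machine. -/
def outStmt (φ : Bool → tm.Γ tm.k₀) (q : Option M.Q) : Option Bool → M.CompStmt tm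
  | some b => .push (.inr tm.k₀) (fun _ => φ b) (contStmt q)
  | none => contStmt q

/-- The statement which performs an action of the transducer. -/
def pushStmt (φ : Bool → tm.Γ tm.k₀) (b : Option Bool) (q : Option M.Q) :
    List (Σ k, M.Γ k) → M.CompStmt tm
  | p :: l => .push (.inl p.1) (fun _ => p.2) (pushStmt φ b q l)
  | [] => outStmt φ q b

open Classical in
/-- The statement which selects the action belonging to the popped symbol. -/
noncomputable def dispatchStmt (φ : Bool → tm.Γ tm.k₀) (q : M.Q) :
    List (Option (M.Γ (M.src q))) → M.CompStmt tm
  | [] => .halt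
  | x :: l => .branch (fun s => decide (s.1 = x.map (Sigma.mk (M.src q))))
      (pushStmt φ (M.act q x).2.1 (M.act q x).2.2 (M.act q x).1) (dispatchStmt φ q l)

/-- The program of the composite machine. -/
noncomputable def compProgram (φ : Bool → tm.Γ tm.k₀) : M.Q ⊕ tm.Λ → M.CompStmt tm
  | .inl q => .pop (.inl (M.src q)) (fun s x => (x.map (Sigma.mk (M.src q)), s.2))
      (dispatchStmt φ q Finset.univ.toList)
  | .inr l => liftStmt (tm.m l)

/-- A configuration of the transducer, as a configuration of the composite machine. -/
def compCfg (φ : Bool → tm.Γ tm.k₀) (c : M.Cfg) :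
    TM2.Cfg (M.compΓ tm) (M.Q ⊕ tm.Λ) (M.CompState tm) :=
  ⟨some (c.state.elim (.inr tm.main) .inl), (none, tm.initialState),
    M.compStk tm c.stk (inputStk tm (c.out.map φ))⟩

/-- `compCfg` sends the stopped state to the label `tm.main`, so the end of the transducer and the
start of the Turing machine need no separate treatment here. -/
theorem stepAux_pushStmt (φ : Bool → tm.Γ tm.k₀) (l : List (Σ k, M.Γ k)) (b : Option Bool)
    (q : Option M.Q) (r : Option (Σ k, M.Γ k)) (S : ∀ k, List (M.Γ k)) (o : List Bool) :
    TM2.stepAux (pushStmt φ b q l) (r, tm.initialState)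
        (M.compStk tm S (inputStk tm (o.map φ))) =
      compCfg φ ⟨q, M.pushAll l S, b.toList ++ o⟩ := by
  induction l generalizing S with
  | cons p l ih =>
    simp only [pushStmt, TM2.stepAux, pushAll]
    erw [update_compStk_inl]
    exact ih _
  | nil =>
    have key : ∀ o : List Bool, TM2.stepAux (contStmt q) (r, tm.initialState)
        (M.compStk tm S (inputStk tm (o.map φ))) = compCfg φ ⟨q, S, o⟩ := by
      intro o
      cases q <;> rfl
    cases b with
    | none => exact key o
    | some b =>
      simp only [pushStmt, outStmt, TM2.stepAux, pushAll]
      erw [update_compStk_inr]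
      have h : Function.update (inputStk tm (o.map φ)) tm.k₀ (φ b :: inputStk tm (o.map φ) tm.k₀) =
          inputStk tm ((b :: o).map φ) := by
        simp [inputStk]
      refine Eq.trans ?_ (key (b :: o))
      rw [← h]
      rfl

/-- Statements branch only on Booleans, so the popped symbol is found by testing all candidates in
turn. `Sigma.mk` is injective, so no earlier test can succeed for a different symbol. -/
theorem stepAux_dispatchStmt (φ : Bool → tm.Γ tm.k₀) (q : M.Q) (x : Option (M.Γ (M.src q)))
    (l : List (Option (M.Γ (M.src q)))) (hx : x ∈ l) (s : tm.σ) (S : ∀ k, List (M.compΓ tm k)) :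
    TM2.stepAux (dispatchStmt φ q l) (x.map (Sigma.mk (M.src q)), s) S =
      TM2.stepAux (pushStmt φ (M.act q x).2.1 (M.act q x).2.2 (M.act q x).1)
        (x.map (Sigma.mk (M.src q)), s) S := by
  induction l with
  | nil => simp at hx
  | cons y l ih =>
    simp only [dispatchStmt, TM2.stepAux]
    by_cases h : x = y
    · subst h; simp
    · have h' : x.map (Sigma.mk (M.src q)) ≠ y.map (Sigma.mk (M.src q)) := fun e =>
        h (Option.map_injective sigma_mk_injective e)
      simp only [h', decide_false, cond_false]
      exact ih (by simpa [h] using hx)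

theorem step_compCfg (φ : Bool → tm.Γ tm.k₀) (q : M.Q) (S : ∀ k, List (M.Γ k)) (o : List Bool) :
    TM2.step (compProgram φ) (compCfg φ ⟨some q, S, o⟩) = some (compCfg φ (M.next q S o)) := by
  have := stepAux_dispatchStmt (M := M) (tm := tm) φ q (S (M.src q)).head? Finset.univ.toList
    (by simp) tm.initialState
    (M.compStk tm (Function.update S (M.src q) (S (M.src q)).tail) (inputStk tm (o.map φ)))
  rw [stepAux_pushStmt] at this
  rw [next, ← this]
  simp only [compCfg, Option.elim, TM2.step, compProgram, TM2.stepAux]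
  erw [update_compStk_inl]
  rfl

theorem Reach.evalsTo (φ : Bool → tm.Γ tm.k₀) {t : ℕ} {c c' : M.Cfg} (h : M.Reach t c c') :
    Nonempty (StateTransition.EvalsToInTime (TM2.step (compProgram φ)) (compCfg φ c)
      (some (compCfg φ c')) t) := by
  induction h with
  | refl t c => exact ⟨⟨⟨0, rfl⟩, Nat.zero_le _⟩⟩
  | @head t q S o c _ ih =>
    obtain ⟨e⟩ := ih
    refine ⟨⟨⟨e.steps + 1, ?_⟩, Nat.succ_le_succ e.steps_le_m⟩⟩
    rw [Function.iterate_succ_apply]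
    refine Eq.trans ?_ e.evals_in_steps
    exact congrArg _ (step_compCfg φ q S o)

/-- From a lifted configuration the composite machine simulates the Turing machine step by step, and
it halts exactly when the latter does. -/
theorem iterate_liftCfg (φ : Bool → tm.Γ tm.k₀) (n : ℕ) (c : Option (TM2.Cfg tm.Γ tm.Λ tm.σ)) :
    (flip bind (TM2.step (compProgram (M := M) φ)))^[n] (c.map liftCfg) =
      ((flip bind (TM2.step tm.m))^[n] c).map liftCfg := by
  induction n generalizing c with
  | zero => rfl
  | succ n ih =>
    rw [Function.iterate_succ_apply, Function.iterate_succ_apply, ← ih]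
    congr 1
    rcases c with _ | ⟨_ | l, s, S⟩
    · rfl
    · rfl
    · exact congrArg some (stepAux_liftStmt (tm.m l) s S)

variable (M) in
/-- The composite machine. -/
noncomputable def comp (tm : FinTM2) (φ : Bool → tm.Γ tm.k₀) : FinTM2 :=
  letI := tm.kFin
  letI := tm.ΛFin
  letI := tm.σFin
  { K := M.K ⊕ tm.K
    k₀ := .inl M.input
    k₁ := .inr tm.k₁
    Γ := M.compΓ tm
    Λ := M.Q ⊕ tm.Λ
    main := .inl M.start
    σ := M.CompState tm
    initialState := (none, tm.initialState)
    Γk₀Fin := inferInstanceAs (Fintype (M.Γ M.input))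
    m := compProgram φ }

theorem compStk_nil :
    M.compStk tm (fun _ => []) (fun _ => []) = fun _ => [] := by
  funext k
  cases k <;> rfl

theorem initList_comp (φ : Bool → tm.Γ tm.k₀) (x : List Bool) :
    initList (M.comp tm φ) (x.map M.inputEquiv.symm) = compCfg φ (M.initCfg x) := by
  have e : (initList (M.comp tm φ) (x.map M.inputEquiv.symm)).stk =
      M.compStk tm (M.initCfg x).stk (inputStk tm ([].map φ)) := by
    refine (initList_stk (M.comp tm φ) (x.map M.inputEquiv.symm)).trans ?_
    have h : inputStk tm ([].map φ) = fun _ => [] :=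
      Function.update_eq_self tm.k₀ (fun _ => [])
    rw [h]
    refine Eq.trans ?_ (update_compStk_inl (fun _ => []) (fun _ => []) M.input
      (x.map M.inputEquiv.symm))
    rw [compStk_nil]
    rfl
  exact congrArg (TM2.Cfg.mk (Γ := M.compΓ tm) (some (Sum.inl M.start : M.Q ⊕ tm.Λ))
    ((none, tm.initialState) : M.CompState tm)) e

/-- A halting configuration has all stacks empty except the output stack. This is why the transducer
is required to end with empty stacks. -/
theorem haltList_comp (φ : Bool → tm.Γ tm.k₀) (y : List (tm.Γ tm.k₁)) :
    haltList (M.comp tm φ) y = liftCfg (haltList tm y) := by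
  have e : (haltList (M.comp tm φ) y).stk = M.compStk tm (fun _ => []) (haltList tm y).stk := by
    refine (haltList_stk (M.comp tm φ) y).trans ?_
    rw [haltList_stk]
    refine Eq.trans ?_ (update_compStk_inr (fun _ => []) (fun _ => []) tm.k₁ y)
    rw [compStk_nil]
    rfl
  exact congrArg (TM2.Cfg.mk (Γ := M.compΓ tm) (none : Option (M.Q ⊕ tm.Λ))
    ((none, tm.initialState) : M.CompState tm)) e

end StackTransducer

/-- `P` is closed under preimages with respect to the functions which are computed by a stack
transducer in polynomial time. -/
theorem InP.of_stackTransducer {α β : Type} {enc : α → List Bool} {enc' : β → List Bool}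
    {p : α → Prop} {p' : β → Prop} (h : InP enc' p') (f : α → β) (hf : ∀ a, p a ↔ p' (f a))
    (M : StackTransducer) (time : Polynomial ℕ)
    (hM : ∀ a, M.Reach (time.eval (enc a).length) (M.initCfg (enc a)) (M.doneCfg (enc' (f a)))) :
    InP enc p := by
  classical
  obtain ⟨C⟩ := h
  let φ := C.inputAlphabet.symm
  have key : ∀ a, Nonempty (TM2OutputsInTime (M.comp C.tm φ) ((enc a).map M.inputEquiv.symm)
      (some ((Computability.encodeBool (decide (p a))).map C.outputAlphabet.invFun))
      ((time + C.time.comp time).eval (enc a).length)) := by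
    intro a
    obtain ⟨e⟩ := (hM a).evalsTo φ
    have e' := C.outputsFun (f a)
    have hlen : (enc' (f a)).length ≤ time.eval (enc a).length := by
      simpa [StackTransducer.doneCfg, StackTransducer.initCfg] using (hM a).length_out_le
    -- The transducer has left its own stacks empty and its output on the input stack, which is a
    -- lifted initial configuration.
    have hstart : StackTransducer.compCfg φ (M.doneCfg (enc' (f a))) =
        StackTransducer.liftCfg (initList C.tm ((enc' (f a)).map φ)) := by
      refine Eq.trans ?_ (congrArg (fun S => (⟨some (.inr C.tm.main), (none, C.tm.initialState),
        M.compStk C.tm (fun _ => []) S⟩ : TM2.Cfg (M.compΓ C.tm) (M.Q ⊕ C.tm.Λ)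
          (M.CompState C.tm))) (initList_stk C.tm ((enc' (f a)).map φ)).symm)
      rfl
    refine ⟨⟨⟨e'.steps + e.steps, ?_⟩, ?_⟩⟩
    · rw [StackTransducer.initList_comp]
      refine (Function.iterate_add_apply _ _ _ _).trans ?_
      have h1 := e.evals_in_steps
      erw [h1]
      rw [hstart]
      have h2 := StackTransducer.iterate_liftCfg (M := M) φ e'.steps
        (some (initList C.tm ((enc' (f a)).map φ)))
      refine h2.trans ?_
      have h3 := e'.evals_in_steps
      erw [h3]
      rw [decide_eq_decide.2 (hf a)]
      exact congrArg some (StackTransducer.haltList_comp (M := M) φ _).symm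
    · have h1 := e.steps_le_m
      have h2 := e'.steps_le_m
      -- Polynomials with natural coefficients are monotone.
      have h3 : C.time.eval (enc' (f a)).length ≤ C.time.eval (time.eval (enc a).length) := by
        rw [Polynomial.eval_eq_sum, Polynomial.eval_eq_sum]
        exact Finset.sum_le_sum fun i _ => Nat.mul_le_mul_left _ (Nat.pow_le_pow_left hlen _)
      rw [Polynomial.eval_add, Polynomial.eval_comp]
      change e'.steps + e.steps ≤ _
      omega
  exact ⟨⟨⟨M.comp C.tm φ, M.inputEquiv, C.outputAlphabet⟩, time + C.time.comp time,
    fun a => (key a).some⟩⟩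

/-! ### The propagation machine -/

/-- The positions in the scopes of constraints. -/
abbrev Pos {k : ℕ} (ar : Fin k → ℕ) : Type := Σ i : Fin k, Fin (ar i)

/-- The constraint relations together with a value for each entry of the scope. -/
abbrev ScopeVal {k : ℕ} (ar : Fin k → ℕ) (C : Type) : Type := Σ i : Fin k, (Fin (ar i) → C)

/-- The data of a propagation algorithm. Each variable has a value in `C`, initially `top`. The
values of the variables of a constraint `i` determine proposals for new values, and a proposal is
accepted if it is better than the current value. -/
structure Propagator {k : ℕ} (ar : Fin k → ℕ) where
  C : Type
  [fintypeC : Fintype C]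
  top : C
  upd : ∀ i, (Fin (ar i) → C) → Fin (ar i) → C
  better : C → C → Bool

namespace Propagator

attribute [instance] fintypeC

/-- The symbols of the internal representation of the constraints. A constraint is written as
`opn i`, followed by the variables of its scope, followed by `cls`, which stores the values which
the variables had when they were last looked up. -/
inductive Sym {k : ℕ} (ar : Fin k → ℕ) (C : Type) : Type
  | opn (i : Fin k)
  | lft (p : Pos ar)
  | one
  | rgt (p : Pos ar)
  | cls (q : ScopeVal ar C)
  deriving Fintype

/-- The stacks: the input, the parts of the constraints to the right and to the left of the current
position, and the values of the variables from the current one on and before it. -/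
inductive Stk : Type
  | inp | fwd | bwd | mem | tmp
  deriving DecidableEq

instance : Fintype Stk :=
  ⟨{.inp, .fwd, .bwd, .mem, .tmp}, fun s => by cases s <;> decide⟩

set_option synthInstance.maxSize 1000 in
set_option synthInstance.maxHeartbeats 200000 in
/-- The states. -/
inductive State {k : ℕ} (ar : Fin k → ℕ) (C : Type) (k' : ℕ) : Type
  | readNum
  | readCons
  | readHdr (i : Fin k)
  | readVar (p : Pos ar)
  | bwdPass (f : Bool) (r : Pos ar → C)
  | bwdMove (f : Bool) (r : Pos ar → C)
  | bwdWrite (f : Bool) (r : Pos ar → C) (p : Pos ar)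
  | bwdRewind (f : Bool) (r : Pos ar → C)
  | fwdPass (f : Bool) (r : Pos ar → C)
  | fwdMove (f : Bool) (r : Pos ar → C)
  | fwdRead (f : Bool) (r : Pos ar → C) (p : Pos ar)
  | fwdRewind (f : Bool) (r : Pos ar → C)
  | outPass (c : Fin (k' + 1))
  | outHdr (c : Fin (k' + 1))
  | outNum
  deriving Fintype


variable {k : ℕ} {ar : Fin k → ℕ} (P : Propagator ar)

/-- The number of constraint relations of the output. -/
noncomputable abbrev num : ℕ := Fintype.card (ScopeVal ar P.C)

/-- The numbering of the constraint relations of the output. -/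
noncomputable def numbering : ScopeVal ar P.C ≃ Fin P.num := Fintype.equivFin _

/-- The proposals for the scope values `q`. -/
def proposals (q : ScopeVal ar P.C) (p : Pos ar) : P.C :=
  if h : q.1 = p.1 then P.upd p.1 (fun j => q.2 (Fin.cast (by rw [h]) j)) p.2 else P.top

theorem proposals_mk (i : Fin k) (v : Fin (ar i) → P.C) (j : Fin (ar i)) :
    P.proposals ⟨i, v⟩ ⟨i, j⟩ = P.upd i v j := by
  simp [proposals]

/-- The alphabets of the stacks. -/
abbrev Alph : Stk → Type
  | .inp => Bool
  | .fwd => Sym ar P.C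
  | .bwd => Sym ar P.C
  | .mem => P.C
  | .tmp => P.C

instance : ∀ s, Fintype (P.Alph s)
  | .inp => inferInstanceAs (Fintype Bool)
  | .fwd => inferInstanceAs (Fintype (Sym ar P.C))
  | .bwd => inferInstanceAs (Fintype (Sym ar P.C))
  | .mem => P.fintypeC
  | .tmp => P.fintypeC

/-- The result of an action. -/
abbrev Res : Type := List (Σ s, P.Alph s) × Option Bool × Option (State ar P.C P.num)

/-- The stack from which a symbol is popped. -/
def source : State ar P.C P.num → Stk
  | .readNum | .readCons | .readHdr _ | .readVar _ => .inp
  | .bwdPass .. => .bwd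
  | .bwdMove .. | .bwdWrite .. => .mem
  | .bwdRewind .. => .tmp
  | .fwdPass .. => .fwd
  | .fwdMove .. | .fwdRead .. => .mem
  | .fwdRewind .. => .tmp
  | .outPass _ => .bwd
  | .outHdr _ => .inp
  | .outNum => .mem

/-- Starting to read the entry `j` of the scope of a constraint `i`. -/
def startVar (i : Fin k) (j : ℕ) : Sym ar P.C × State ar P.C P.num :=
  if h : j < ar i then (.lft ⟨i, ⟨j, h⟩⟩, .readVar ⟨i, ⟨j, h⟩⟩)
  else (.cls ⟨i, fun _ => P.top⟩, .readCons)

open Classical in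
/-- The actions of the machine. -/
noncomputable def action : ∀ q : State ar P.C P.num, Option (P.Alph (P.source q)) → P.Res
  | .readNum => fun
    | some true => ([⟨.mem, P.top⟩], none, some .readNum)
    | _ => ([], none, some .readCons)
  | .readCons => fun
    | some true => ([], none, some (if h : 0 < k then .readHdr ⟨0, h⟩ else .readCons))
    | _ => ([], some false, some (.bwdPass false fun _ => P.top))
  | .readHdr i => fun
    | some true => ([], none, some (.readHdr (if h : i + 1 < k then ⟨i + 1, h⟩ else i)))
    | _ => ([⟨.bwd, .opn i⟩, ⟨.bwd, (P.startVar i 0).1⟩], none, some (P.startVar i 0).2)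
  | .readVar p => fun
    | some true => ([⟨.bwd, .one⟩], none, some (.readVar p))
    | _ => ([⟨.bwd, .rgt p⟩, ⟨.bwd, (P.startVar p.1 (p.2 + 1)).1⟩], none,
        some (P.startVar p.1 (p.2 + 1)).2)
  | .bwdPass f r => fun
    | some (.opn i) => ([⟨.fwd, .opn i⟩], none, some (.bwdPass f r))
    | some (.lft p) => ([⟨.fwd, .lft p⟩], none, some (.bwdWrite f r p))
    | some .one => ([⟨.fwd, .one⟩], none, some (.bwdMove f r))
    | some (.rgt p) => ([⟨.fwd, .rgt p⟩], none, some (.bwdPass f r))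
    | some (.cls q) => ([⟨.fwd, .cls q⟩], none, some (.bwdPass f (P.proposals q)))
    | none => ([], none, some (.fwdPass f r))
  | .bwdMove f r => fun
    | some a => ([⟨.tmp, a⟩], none, some (.bwdPass f r))
    | none => ([], none, some (.bwdPass f r))
  | .bwdWrite f r p => fun
    | some a => ([⟨.mem, if P.better (r p) a then r p else a⟩], none,
        some (.bwdRewind (f || P.better (r p) a) r))
    | none => ([], none, some (.bwdRewind f r))
  | .bwdRewind f r => fun
    | some a => ([⟨.mem, a⟩], none, some (.bwdRewind f r))
    | none => ([], none, some (.bwdPass f r))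
  | .fwdPass f r => fun
    | some (.opn i) => ([⟨.bwd, .opn i⟩], none, some (.fwdPass f r))
    | some (.lft p) => ([⟨.bwd, .lft p⟩], none, some (.fwdPass f r))
    | some .one => ([⟨.bwd, .one⟩], none, some (.fwdMove f r))
    | some (.rgt p) => ([⟨.bwd, .rgt p⟩], none, some (.fwdRead f r p))
    | some (.cls q) => ([⟨.bwd, .cls ⟨q.1, fun j => r ⟨q.1, j⟩⟩⟩], none, some (.fwdPass f r))
    | none => ([], none, some (bif f then .bwdPass false r else .outPass 0))
  | .fwdMove f r => fun
    | some a => ([⟨.tmp, a⟩], none, some (.fwdPass f r))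
    | none => ([], none, some (.fwdPass f r))
  | .fwdRead f r p => fun
    | some a => ([⟨.mem, a⟩], none, some (.fwdRewind f (Function.update r p a)))
    | none => ([], none, some (.fwdRewind f r))
  | .fwdRewind f r => fun
    | some a => ([⟨.mem, a⟩], none, some (.fwdRewind f r))
    | none => ([], none, some (.fwdPass f r))
  | .outPass c => fun
    | some (.opn _) => ([], some false, some (.outHdr c))
    | some (.lft _) => ([], none, some (.outPass c))
    | some .one => ([], some true, some (.outPass c))
    | some (.rgt _) => ([], some false, some (.outPass c))
    | some (.cls q) => ([], none, some (.outPass (P.numbering q).castSucc))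
    | none => ([], some false, some .outNum)
  | .outHdr c => fun _ => ([], some true, some (match c with
    | ⟨0, _⟩ => .outPass 0
    | ⟨c + 1, h⟩ => .outHdr ⟨c, Nat.lt_of_succ_lt h⟩))
  | .outNum => fun
    | some _ => ([], some true, some .outNum)
    | none => ([], none, none)

/-- The propagation machine. -/
noncomputable def machine : StackTransducer where
  K := Stk
  Γ := P.Alph
  Q := State ar P.C P.num
  input := .inp
  inputEquiv := Equiv.refl _
  start := .readNum
  src := P.source
  act := P.action

/-- The contents of the stacks. -/
def stk (i : List Bool) (f b : List (Sym ar P.C)) (m t : List P.C) : ∀ s, List (P.Alph s)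
  | .inp => i
  | .fwd => f
  | .bwd => b
  | .mem => m
  | .tmp => t

/-- The configurations of the propagation machine. -/
noncomputable def cfg (q : Option (State ar P.C P.num)) (i : List Bool) (f b : List (Sym ar P.C))
    (m t : List P.C) (o : List Bool) : P.machine.Cfg :=
  ⟨q, P.stk i f b m t, o⟩

/-! ### Single transitions of the propagation machine -/

variable {P} {i : List Bool} {f b : List (Sym ar P.C)} {m t : List P.C} {o : List Bool}
  {n : ℕ} {c : P.machine.Cfg}

theorem reach_succ {q : State ar P.C P.num} {c' : P.machine.Cfg}
    (h : P.machine.Reach n c' c)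
    (hc : P.machine.next q (P.stk i f b m t) o = c') :
    P.machine.Reach (n + 1) (P.cfg (some q) i f b m t o) c :=
  .head (hc ▸ h)

theorem reach_readNum_true
    (h : P.machine.Reach n (P.cfg (some .readNum) i f b (P.top :: m) t o) c) :
    P.machine.Reach (n + 1) (P.cfg (some .readNum) (true :: i) f b m t o) c := by
  refine reach_succ h (StackTransducer.Cfg.ext rfl (funext fun s => ?_) rfl)
  cases s <;> rfl

theorem reach_readNum_false
    (h : P.machine.Reach n (P.cfg (some .readCons) i f b m t o) c) :
    P.machine.Reach (n + 1) (P.cfg (some .readNum) (false :: i) f b m t o) c := by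
  refine reach_succ h (StackTransducer.Cfg.ext rfl (funext fun s => ?_) rfl)
  cases s <;> rfl

theorem reach_readCons_true (hk : 0 < k)
    (h : P.machine.Reach n (P.cfg (some (.readHdr ⟨0, hk⟩)) i f b m t o) c) :
    P.machine.Reach (n + 1) (P.cfg (some .readCons) (true :: i) f b m t o) c := by
  refine reach_succ h (StackTransducer.Cfg.ext ?_ (funext fun s => ?_) rfl)
  · exact congrArg some (dif_pos hk)
  · cases s <;> rfl

/-- The output grows to the left, so the final `0` of its code is the first bit to be written. -/
theorem reach_readCons_false
    (h : P.machine.Reach n (P.cfg (some (.bwdPass false fun _ => P.top)) i f b m t (false :: o)) c) :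
    P.machine.Reach (n + 1) (P.cfg (some .readCons) (false :: i) f b m t o) c := by
  refine reach_succ h (StackTransducer.Cfg.ext rfl (funext fun s => ?_) rfl)
  cases s <;> rfl

theorem reach_readVar_true {p : Pos ar}
    (h : P.machine.Reach n (P.cfg (some (.readVar p)) i f (.one :: b) m t o) c) :
    P.machine.Reach (n + 1) (P.cfg (some (.readVar p)) (true :: i) f b m t o) c := by
  refine reach_succ h (StackTransducer.Cfg.ext rfl (funext fun s => ?_) rfl)
  cases s <;> rfl

theorem reach_bwd_opn {g : Bool} {r : Pos ar → P.C} {j : Fin k}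
    (h : P.machine.Reach n (P.cfg (some (.bwdPass g r)) i (.opn j :: f) b m t o) c) :
    P.machine.Reach (n + 1) (P.cfg (some (.bwdPass g r)) i f (.opn j :: b) m t o) c := by
  refine reach_succ h (StackTransducer.Cfg.ext rfl (funext fun s => ?_) rfl)
  cases s <;> rfl

theorem reach_bwd_lft {g : Bool} {r : Pos ar → P.C} {p : Pos ar}
    (h : P.machine.Reach n (P.cfg (some (.bwdWrite g r p)) i (.lft p :: f) b m t o) c) :
    P.machine.Reach (n + 1) (P.cfg (some (.bwdPass g r)) i f (.lft p :: b) m t o) c := by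
  refine reach_succ h (StackTransducer.Cfg.ext rfl (funext fun s => ?_) rfl)
  cases s <;> rfl

theorem reach_bwd_rgt {g : Bool} {r : Pos ar → P.C} {p : Pos ar}
    (h : P.machine.Reach n (P.cfg (some (.bwdPass g r)) i (.rgt p :: f) b m t o) c) :
    P.machine.Reach (n + 1) (P.cfg (some (.bwdPass g r)) i f (.rgt p :: b) m t o) c := by
  refine reach_succ h (StackTransducer.Cfg.ext rfl (funext fun s => ?_) rfl)
  cases s <;> rfl

theorem reach_bwd_one {g : Bool} {r : Pos ar → P.C}
    (h : P.machine.Reach n (P.cfg (some (.bwdMove g r)) i (.one :: f) b m t o) c) :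
    P.machine.Reach (n + 1) (P.cfg (some (.bwdPass g r)) i f (.one :: b) m t o) c := by
  refine reach_succ h (StackTransducer.Cfg.ext rfl (funext fun s => ?_) rfl)
  cases s <;> rfl

theorem reach_bwd_move {g : Bool} {r : Pos ar → P.C} {a : P.C}
    (h : P.machine.Reach n (P.cfg (some (.bwdPass g r)) i f b m (a :: t) o) c) :
    P.machine.Reach (n + 1) (P.cfg (some (.bwdMove g r)) i f b (a :: m) t o) c := by
  refine reach_succ h (StackTransducer.Cfg.ext rfl (funext fun s => ?_) rfl)
  cases s <;> rfl

theorem reach_bwdRewind_cons {g : Bool} {r : Pos ar → P.C} {a : P.C}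
    (h : P.machine.Reach n (P.cfg (some (.bwdRewind g r)) i f b (a :: m) t o) c) :
    P.machine.Reach (n + 1) (P.cfg (some (.bwdRewind g r)) i f b m (a :: t) o) c := by
  refine reach_succ h (StackTransducer.Cfg.ext rfl (funext fun s => ?_) rfl)
  cases s <;> rfl

theorem reach_bwdRewind_nil {g : Bool} {r : Pos ar → P.C}
    (h : P.machine.Reach n (P.cfg (some (.bwdPass g r)) i f b m [] o) c) :
    P.machine.Reach (n + 1) (P.cfg (some (.bwdRewind g r)) i f b m [] o) c := by
  refine reach_succ h (StackTransducer.Cfg.ext rfl (funext fun s => ?_) rfl)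
  cases s <;> rfl

theorem reach_fwd_opn {g : Bool} {r : Pos ar → P.C} {j : Fin k}
    (h : P.machine.Reach n (P.cfg (some (.fwdPass g r)) i f (.opn j :: b) m t o) c) :
    P.machine.Reach (n + 1) (P.cfg (some (.fwdPass g r)) i (.opn j :: f) b m t o) c := by
  refine reach_succ h (StackTransducer.Cfg.ext rfl (funext fun s => ?_) rfl)
  cases s <;> rfl

theorem reach_fwd_lft {g : Bool} {r : Pos ar → P.C} {p : Pos ar}
    (h : P.machine.Reach n (P.cfg (some (.fwdPass g r)) i f (.lft p :: b) m t o) c) :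
    P.machine.Reach (n + 1) (P.cfg (some (.fwdPass g r)) i (.lft p :: f) b m t o) c := by
  refine reach_succ h (StackTransducer.Cfg.ext rfl (funext fun s => ?_) rfl)
  cases s <;> rfl

theorem reach_fwd_rgt {g : Bool} {r : Pos ar → P.C} {p : Pos ar}
    (h : P.machine.Reach n (P.cfg (some (.fwdRead g r p)) i f (.rgt p :: b) m t o) c) :
    P.machine.Reach (n + 1) (P.cfg (some (.fwdPass g r)) i (.rgt p :: f) b m t o) c := by
  refine reach_succ h (StackTransducer.Cfg.ext rfl (funext fun s => ?_) rfl)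
  cases s <;> rfl

theorem reach_fwd_one {g : Bool} {r : Pos ar → P.C}
    (h : P.machine.Reach n (P.cfg (some (.fwdMove g r)) i f (.one :: b) m t o) c) :
    P.machine.Reach (n + 1) (P.cfg (some (.fwdPass g r)) i (.one :: f) b m t o) c := by
  refine reach_succ h (StackTransducer.Cfg.ext rfl (funext fun s => ?_) rfl)
  cases s <;> rfl

theorem reach_fwd_move {g : Bool} {r : Pos ar → P.C} {a : P.C}
    (h : P.machine.Reach n (P.cfg (some (.fwdPass g r)) i f b m (a :: t) o) c) :
    P.machine.Reach (n + 1) (P.cfg (some (.fwdMove g r)) i f b (a :: m) t o) c := by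
  refine reach_succ h (StackTransducer.Cfg.ext rfl (funext fun s => ?_) rfl)
  cases s <;> rfl

theorem reach_fwdRewind_cons {g : Bool} {r : Pos ar → P.C} {a : P.C}
    (h : P.machine.Reach n (P.cfg (some (.fwdRewind g r)) i f b (a :: m) t o) c) :
    P.machine.Reach (n + 1) (P.cfg (some (.fwdRewind g r)) i f b m (a :: t) o) c := by
  refine reach_succ h (StackTransducer.Cfg.ext rfl (funext fun s => ?_) rfl)
  cases s <;> rfl

theorem reach_fwdRewind_nil {g : Bool} {r : Pos ar → P.C}
    (h : P.machine.Reach n (P.cfg (some (.fwdPass g r)) i f b m [] o) c) :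
    P.machine.Reach (n + 1) (P.cfg (some (.fwdRewind g r)) i f b m [] o) c := by
  refine reach_succ h (StackTransducer.Cfg.ext rfl (funext fun s => ?_) rfl)
  cases s <;> rfl

theorem reach_bwd_cls {g : Bool} {r : Pos ar → P.C} {q : ScopeVal ar P.C}
    (h : P.machine.Reach n (P.cfg (some (.bwdPass g (P.proposals q))) i (.cls q :: f) b m t o) c) :
    P.machine.Reach (n + 1) (P.cfg (some (.bwdPass g r)) i f (.cls q :: b) m t o) c := by
  refine reach_succ h (StackTransducer.Cfg.ext rfl (funext fun s => ?_) rfl)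
  cases s <;> rfl

theorem reach_bwd_nil {g : Bool} {r : Pos ar → P.C}
    (h : P.machine.Reach n (P.cfg (some (.fwdPass g r)) i f [] m t o) c) :
    P.machine.Reach (n + 1) (P.cfg (some (.bwdPass g r)) i f [] m t o) c := by
  refine reach_succ h (StackTransducer.Cfg.ext rfl (funext fun s => ?_) rfl)
  cases s <;> rfl

theorem reach_bwdWrite {g : Bool} {r : Pos ar → P.C} {p : Pos ar} {a : P.C}
    (h : P.machine.Reach n (P.cfg (some (.bwdRewind (g || P.better (r p) a) r)) i f b ((if P.better (r p) a then r p else a) :: m) t o) c) :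
    P.machine.Reach (n + 1) (P.cfg (some (.bwdWrite g r p)) i f b (a :: m) t o) c := by
  refine reach_succ h (StackTransducer.Cfg.ext rfl (funext fun s => ?_) rfl)
  cases s <;> rfl

theorem reach_fwd_cls {g : Bool} {r : Pos ar → P.C} {q : ScopeVal ar P.C}
    (h : P.machine.Reach n (P.cfg (some (.fwdPass g r)) i f (.cls ⟨q.1, fun j => r ⟨q.1, j⟩⟩ :: b) m t o) c) :
    P.machine.Reach (n + 1) (P.cfg (some (.fwdPass g r)) i (.cls q :: f) b m t o) c := by
  refine reach_succ h (StackTransducer.Cfg.ext rfl (funext fun s => ?_) rfl)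
  cases s <;> rfl

theorem reach_fwd_nil_true {r : Pos ar → P.C}
    (h : P.machine.Reach n (P.cfg (some (.bwdPass false r)) i [] b m t o) c) :
    P.machine.Reach (n + 1) (P.cfg (some (.fwdPass true r)) i [] b m t o) c := by
  refine reach_succ h (StackTransducer.Cfg.ext rfl (funext fun s => ?_) rfl)
  cases s <;> rfl

theorem reach_fwd_nil_false {r : Pos ar → P.C}
    (h : P.machine.Reach n (P.cfg (some (.outPass 0)) i [] b m t o) c) :
    P.machine.Reach (n + 1) (P.cfg (some (.fwdPass false r)) i [] b m t o) c := by
  refine reach_succ h (StackTransducer.Cfg.ext rfl (funext fun s => ?_) rfl)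
  cases s <;> rfl

theorem reach_fwdRead {g : Bool} {r : Pos ar → P.C} {p : Pos ar} {a : P.C}
    (h : P.machine.Reach n (P.cfg (some (.fwdRewind g (Function.update r p a))) i f b (a :: m) t o) c) :
    P.machine.Reach (n + 1) (P.cfg (some (.fwdRead g r p)) i f b (a :: m) t o) c := by
  refine reach_succ h (StackTransducer.Cfg.ext rfl (funext fun s => ?_) rfl)
  cases s <;> rfl

theorem reach_out_opn {q : Fin (P.num + 1)} {j : Fin k}
    (h : P.machine.Reach n (P.cfg (some (.outHdr q)) i f b m t (false :: o)) c) :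
    P.machine.Reach (n + 1) (P.cfg (some (.outPass q)) i f (.opn j :: b) m t o) c := by
  refine reach_succ h (StackTransducer.Cfg.ext rfl (funext fun s => ?_) rfl)
  cases s <;> rfl

theorem reach_out_lft {q : Fin (P.num + 1)} {p : Pos ar}
    (h : P.machine.Reach n (P.cfg (some (.outPass q)) i f b m t o) c) :
    P.machine.Reach (n + 1) (P.cfg (some (.outPass q)) i f (.lft p :: b) m t o) c := by
  refine reach_succ h (StackTransducer.Cfg.ext rfl (funext fun s => ?_) rfl)
  cases s <;> rfl

theorem reach_out_rgt {q : Fin (P.num + 1)} {p : Pos ar}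
    (h : P.machine.Reach n (P.cfg (some (.outPass q)) i f b m t (false :: o)) c) :
    P.machine.Reach (n + 1) (P.cfg (some (.outPass q)) i f (.rgt p :: b) m t o) c := by
  refine reach_succ h (StackTransducer.Cfg.ext rfl (funext fun s => ?_) rfl)
  cases s <;> rfl

theorem reach_out_one {q : Fin (P.num + 1)}
    (h : P.machine.Reach n (P.cfg (some (.outPass q)) i f b m t (true :: o)) c) :
    P.machine.Reach (n + 1) (P.cfg (some (.outPass q)) i f (.one :: b) m t o) c := by
  refine reach_succ h (StackTransducer.Cfg.ext rfl (funext fun s => ?_) rfl)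
  cases s <;> rfl

theorem reach_out_cls {q : Fin (P.num + 1)} {v : ScopeVal ar P.C}
    (h : P.machine.Reach n (P.cfg (some (.outPass (P.numbering v).castSucc)) i f b m t o) c) :
    P.machine.Reach (n + 1) (P.cfg (some (.outPass q)) i f (.cls v :: b) m t o) c := by
  refine reach_succ h (StackTransducer.Cfg.ext rfl (funext fun s => ?_) rfl)
  cases s <;> rfl

theorem reach_out_nil {q : Fin (P.num + 1)}
    (h : P.machine.Reach n (P.cfg (some .outNum) i f [] m t (false :: o)) c) :
    P.machine.Reach (n + 1) (P.cfg (some (.outPass q)) i f [] m t o) c := by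
  refine reach_succ h (StackTransducer.Cfg.ext rfl (funext fun s => ?_) rfl)
  cases s <;> rfl

theorem reach_outHdr_zero {h₀ : 0 < P.num + 1}
    (h : P.machine.Reach n (P.cfg (some (.outPass 0)) [] f b m t (true :: o)) c) :
    P.machine.Reach (n + 1) (P.cfg (some (.outHdr ⟨0, h₀⟩)) [] f b m t o) c := by
  refine reach_succ h (StackTransducer.Cfg.ext rfl (funext fun s => ?_) rfl)
  cases s <;> rfl

theorem reach_outHdr_succ {x : ℕ} {hx : x + 1 < P.num + 1}
    (h : P.machine.Reach n (P.cfg (some (.outHdr ⟨x, Nat.lt_of_succ_lt hx⟩)) [] f b m t (true :: o)) c) :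
    P.machine.Reach (n + 1) (P.cfg (some (.outHdr ⟨x + 1, hx⟩)) [] f b m t o) c := by
  refine reach_succ h (StackTransducer.Cfg.ext rfl (funext fun s => ?_) rfl)
  cases s <;> rfl

theorem reach_outNum_cons {a : P.C}
    (h : P.machine.Reach n (P.cfg (some .outNum) i f b m t (true :: o)) c) :
    P.machine.Reach (n + 1) (P.cfg (some .outNum) i f b (a :: m) t o) c := by
  refine reach_succ h (StackTransducer.Cfg.ext rfl (funext fun s => ?_) rfl)
  cases s <;> rfl

theorem reach_outNum_nil
    (h : P.machine.Reach n (P.cfg (none) i f b [] t o) c) :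
    P.machine.Reach (n + 1) (P.cfg (some .outNum) i f b [] t o) c := by
  refine reach_succ h (StackTransducer.Cfg.ext rfl (funext fun s => ?_) rfl)
  cases s <;> rfl

theorem reach_readHdr_true {j : Fin k} (hj : j + 1 < k)
    (h : P.machine.Reach n (P.cfg (some (.readHdr ⟨j + 1, hj⟩)) i f b m t o) c) :
    P.machine.Reach (n + 1) (P.cfg (some (.readHdr j)) (true :: i) f b m t o) c := by
  refine reach_succ h (StackTransducer.Cfg.ext ?_ (funext fun s => ?_) rfl)
  · exact congrArg (fun x => some (State.readHdr x)) (dif_pos hj)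
  · cases s <;> rfl

theorem reach_readHdr_false {j : Fin k}
    (h : P.machine.Reach n (P.cfg (some (P.startVar j 0).2) i f
      ((P.startVar j 0).1 :: .opn j :: b) m t o) c) :
    P.machine.Reach (n + 1) (P.cfg (some (.readHdr j)) (false :: i) f b m t o) c := by
  refine reach_succ h (StackTransducer.Cfg.ext rfl (funext fun s => ?_) rfl)
  cases s <;> rfl

theorem reach_readVar_false {p : Pos ar}
    (h : P.machine.Reach n (P.cfg (some (P.startVar p.1 (p.2 + 1)).2) i f
      ((P.startVar p.1 (p.2 + 1)).1 :: .rgt p :: b) m t o) c) :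
    P.machine.Reach (n + 1) (P.cfg (some (.readVar p)) (false :: i) f b m t o) c := by
  refine reach_succ h (StackTransducer.Cfg.ext rfl (funext fun s => ?_) rfl)
  cases s <;> rfl

end Propagator
namespace Propagator

variable {k : ℕ} {ar : Fin k → ℕ} {P : Propagator ar} {i : List Bool}
  {f b : List (Sym ar P.C)} {m t : List P.C} {o : List Bool} {N : ℕ}

/-! ### The internal representation of constraints -/

/-- The representation of the variable `x`, standing at the position `p`. -/
def varText {C : Type} (p : Pos ar) (x : ℕ) : List (Sym ar C) :=
  .lft p :: (List.replicate x .one ++ [.rgt p])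

/-- The representation of the variables at the positions `js` of a scope. -/
def scopeText {C : Type} (c : Σ i : Fin k, (Fin (ar i) → Fin N)) (js : List (Fin (ar c.1))) :
    List (Sym ar C) :=
  js.flatMap fun j => varText ⟨c.1, j⟩ (c.2 j)

/-- The representation of a constraint, where the values `v` are stored. -/
def consText {C : Type} (c : Σ i : Fin k, (Fin (ar i) → Fin N)) (v : Fin (ar c.1) → C) :
    List (Sym ar C) :=
  .opn c.1 :: (scopeText c (List.finRange _) ++ [.cls ⟨c.1, v⟩])

/-- The representation of a list of constraints, where the values given by `M` are stored. -/
def text {C : Type} (M : Fin N → C) (cs : List (Σ i : Fin k, (Fin (ar i) → Fin N))) :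
    List (Sym ar C) :=
  cs.flatMap fun c => consText c (M ∘ c.2)

/-- The length of the code of the variables at the positions `js` of a scope. -/
def scopeWeight (c : Σ i : Fin k, (Fin (ar i) → Fin N)) (js : List (Fin (ar c.1))) : ℕ :=
  (js.map fun j => (c.2 j : ℕ) + 1).sum

/-- The length of the code of a constraint. -/
def consWeight (c : Σ i : Fin k, (Fin (ar i) → Fin N)) : ℕ :=
  c.1 + 2 + scopeWeight c (List.finRange _)

/-- The length of the code of a list of constraints. -/
def weight (cs : List (Σ i : Fin k, (Fin (ar i) → Fin N))) : ℕ :=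
  (cs.map consWeight).sum

theorem length_encodeNat (x : ℕ) : (encodeNat x).length = x + 1 := by
  simp [encodeNat]

theorem length_encodeConstraint (c : Σ i : Fin k, (Fin (ar i) → Fin N)) :
    (true :: encodeConstraint c).length = consWeight c := by
  simp only [encodeConstraint, consWeight, scopeWeight, List.length_cons, List.length_append,
    length_encodeNat, List.length_flatMap, List.ofFn_eq_map, List.map_map]
  simp only [Function.comp_def]
  omega

theorem length_encode (I : Instance ar) :
    I.encode.length = I.numVars + weight I.constraints + 2 := by
  have h : (I.constraints.map fun c => (true :: encodeConstraint c).length) =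
      I.constraints.map consWeight := List.map_congr_left fun c _ => length_encodeConstraint c
  simp only [Instance.encode, List.length_append, length_encodeNat, List.length_flatMap, h, weight,
    List.length_singleton]
  omega

/-! ### Moving on the stack of values -/

/-- The same `u` and `v` serve for all `a`, so overwriting the value of `x` replaces one symbol
between two fixed parts of the stack. -/
theorem exists_ofFn_update {C : Type*} (M : Fin N → C) (x : Fin N) :
    ∃ u v : List C, u.length = x ∧ ∀ a, List.ofFn (Function.update M x a) = u ++ a :: v := by
  refine ⟨(List.ofFn M).take x, (List.ofFn M).drop (x + 1), by simp, fun a => ?_⟩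
  have h : (List.ofFn M).set x a = (List.ofFn M).take x ++ a :: (List.ofFn M).drop (x + 1) := by
    rw [List.set_eq_take_append_cons_drop, if_pos (by simp)]
  rw [← h]
  refine List.ext_getElem (by simp) fun j h₁ h₂ => ?_
  simp only [List.getElem_ofFn, List.getElem_set, Function.update_apply, Fin.ext_iff]
  by_cases h : j = x
  · simp [h]
  · simp [h, Ne.symm h]

theorem exists_ofFn_eq {C : Type*} (M : Fin N → C) (x : Fin N) :
    ∃ u v : List C, u.length = x ∧ List.ofFn M = u ++ M x :: v := by
  obtain ⟨u, v, h, h'⟩ := exists_ofFn_update M x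
  exact ⟨u, v, h, by simpa using h' (M x)⟩

theorem replicate_append_cons {α : Type*} (n : ℕ) (a : α) (l : List α) :
    List.replicate n a ++ a :: l = a :: (List.replicate n a ++ l) := by
  rw [← List.cons_append, ← List.replicate_succ, List.replicate_succ']
  simp

theorem reach_bwd_ones (g : Bool) (r : Pos ar → P.C) (u : List P.C) :
    P.machine.Reach (2 * u.length)
      (P.cfg (some (.bwdPass g r)) i f (List.replicate u.length .one ++ b) (u ++ m) t o)
      (P.cfg (some (.bwdPass g r)) i (List.replicate u.length .one ++ f) b m
        (u.reverse ++ t) o) := by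
  induction u generalizing f t with
  | nil => exact .refl _ _
  | cons a u ih =>
    refine reach_bwd_one (n := 2 * u.length + 1) (reach_bwd_move ?_)
    simpa [replicate_append_cons, List.replicate_succ] using ih (f := .one :: f) (t := a :: t)

theorem reach_fwd_ones (g : Bool) (r : Pos ar → P.C) (u : List P.C) :
    P.machine.Reach (2 * u.length)
      (P.cfg (some (.fwdPass g r)) i (List.replicate u.length .one ++ f) b (u ++ m) t o)
      (P.cfg (some (.fwdPass g r)) i f (List.replicate u.length .one ++ b) m
        (u.reverse ++ t) o) := by
  induction u generalizing b t with
  | nil => exact .refl _ _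
  | cons a u ih =>
    refine reach_fwd_one (n := 2 * u.length + 1) (reach_fwd_move ?_)
    simpa [replicate_append_cons, List.replicate_succ] using ih (b := .one :: b) (t := a :: t)

theorem reach_bwd_rewind (g : Bool) (r : Pos ar → P.C) (u : List P.C) :
    P.machine.Reach (u.length + 1) (P.cfg (some (.bwdRewind g r)) i f b m u o)
      (P.cfg (some (.bwdPass g r)) i f b (u.reverse ++ m) [] o) := by
  induction u generalizing m with
  | nil => exact reach_bwdRewind_nil (.refl _ _)
  | cons a u ih => exact reach_bwdRewind_cons (by simpa using ih (m := a :: m))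

theorem reach_fwd_rewind (g : Bool) (r : Pos ar → P.C) (u : List P.C) :
    P.machine.Reach (u.length + 1) (P.cfg (some (.fwdRewind g r)) i f b m u o)
      (P.cfg (some (.fwdPass g r)) i f b (u.reverse ++ m) [] o) := by
  induction u generalizing m with
  | nil => exact reach_fwdRewind_nil (.refl _ _)
  | cons a u ih => exact reach_fwdRewind_cons (by simpa using ih (m := a :: m))

/-! ### The backward pass -/

/-- Propose the value `xa.2` for the variable `xa.1`. The first component of the state records
whether some proposal has been accepted. -/
def propose (P : Propagator ar) (s : Bool × (Fin N → P.C)) (xa : Fin N × P.C) :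
    Bool × (Fin N → P.C) :=
  (s.1 || P.better xa.2 (s.2 xa.1),
    if P.better xa.2 (s.2 xa.1) then Function.update s.2 xa.1 xa.2 else s.2)

/-- Each of the `x` symbols `one` moves one value to the auxiliary stack, so at `lft` the value of
`x` is on top and can be replaced; afterwards the values are moved back. This takes `2x` steps for
the moves, `x + 1` for the way back and three more, at most `4(x + 1)`. -/
theorem reach_bwd_var (s : Bool × (Fin N → P.C)) (r : Pos ar → P.C) (p : Pos ar) (x : Fin N) :
    P.machine.Reach (4 * (x + 1))
      (P.cfg (some (.bwdPass s.1 r)) i f ((varText p x).reverse ++ b) (List.ofFn s.2) [] o)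
      (P.cfg (some (.bwdPass (P.propose s (x, r p)).1 r)) i (varText p x ++ f) b
        (List.ofFn (P.propose s (x, r p)).2) [] o) := by
  obtain ⟨u, v, hu, huv⟩ := exists_ofFn_update s.2 x
  have h₁ : List.ofFn s.2 = u ++ s.2 x :: v := by simpa using huv (s.2 x)
  have h₂ : List.ofFn (P.propose s (x, r p)).2 =
      u ++ (if P.better (r p) (s.2 x) then r p else s.2 x) :: v := by
    simp only [propose]
    split
    · exact huv _
    · exact h₁
  have h₃ := reach_bwd_ones (P := P) (i := i) (f := .rgt p :: f) (b := .lft p :: b)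
    (m := s.2 x :: v) (t := []) (o := o) s.1 r u
  have h₄ := reach_bwd_rewind (P := P) (i := i) (f := varText p x ++ f) (b := b)
    (m := (if P.better (r p) (s.2 x) then r p else s.2 x) :: v) (o := o)
    (s.1 || P.better (r p) (s.2 x)) r u.reverse
  have h₅ := h₃.trans (reach_bwd_lft (reach_bwdWrite (by
    simpa [varText, hu] using h₄)))
  rw [h₁, h₂]
  refine StackTransducer.Reach.mono ?_
    (show 2 * u.length + (u.reverse.length + 1 + 1 + 1) + 1 ≤ _ by simp; omega)
  simpa [varText, propose, hu] using reach_bwd_rgt h₅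

theorem reach_bwd_scope (s : Bool × (Fin N → P.C)) (r : Pos ar → P.C)
    (c : Σ i : Fin k, (Fin (ar i) → Fin N)) (js : List (Fin (ar c.1))) :
    P.machine.Reach (4 * scopeWeight c js)
      (P.cfg (some (.bwdPass s.1 r)) i f ((scopeText c js).reverse ++ b) (List.ofFn s.2) [] o)
      (P.cfg (some (.bwdPass
          ((js.reverse.map fun j => (c.2 j, r ⟨c.1, j⟩)).foldl P.propose s).1 r)) i
        (scopeText c js ++ f) b
        (List.ofFn ((js.reverse.map fun j => (c.2 j, r ⟨c.1, j⟩)).foldl P.propose s).2) [] o) := by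
  induction js using List.reverseRecOn generalizing s f with
  | nil => exact .refl _ _
  | append_singleton js j ih =>
    have h := (reach_bwd_var (P := P) (i := i) (f := f) (b := (scopeText c js).reverse ++ b)
      (o := o) s r ⟨c.1, j⟩ (c.2 j)).trans (ih _)
    refine StackTransducer.Reach.mono (?_ : P.machine.Reach _ _ _)
      (show 4 * (c.2 j + 1) + 4 * scopeWeight c js ≤ _ by simp [scopeWeight]; omega)
    simpa [scopeText] using h

/-- The proposals made for the variables of a constraint if the current values are `M`. -/
def consProposals (P : Propagator ar) (M : Fin N → P.C) (c : Σ i : Fin k, (Fin (ar i) → Fin N)) :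
    List (Fin N × P.C) :=
  (List.finRange _).reverse.map fun j => (c.2 j, P.upd c.1 (M ∘ c.2) j)

/-- The result of the proposals for all constraints. -/
def round (P : Propagator ar) (M : Fin N → P.C) (cs : List (Σ i : Fin k, (Fin (ar i) → Fin N)))
    (s : Bool × (Fin N → P.C)) : Bool × (Fin N → P.C) :=
  (cs.reverse.flatMap (P.consProposals M)).foldl P.propose s

/-- Going backwards, `cls` is met before the scope. The stored values thus determine all proposals
of the constraint before its first variable is visited. -/
theorem reach_bwd_cons (s : Bool × (Fin N → P.C)) (r : Pos ar → P.C) (M : Fin N → P.C)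
    (c : Σ i : Fin k, (Fin (ar i) → Fin N)) :
    ∃ r', P.machine.Reach (4 * consWeight c)
      (P.cfg (some (.bwdPass s.1 r)) i f ((consText c (M ∘ c.2)).reverse ++ b)
        (List.ofFn s.2) [] o)
      (P.cfg (some (.bwdPass ((P.consProposals M c).foldl P.propose s).1 r')) i
        (consText c (M ∘ c.2) ++ f) b
        (List.ofFn ((P.consProposals M c).foldl P.propose s).2) [] o) := by
  have h := reach_bwd_scope (P := P) (i := i) (f := .cls ⟨c.1, M ∘ c.2⟩ :: f)
    (b := .opn c.1 :: b) (o := o) s (P.proposals ⟨c.1, M ∘ c.2⟩) c (List.finRange _)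
  simp only [proposals_mk] at h
  refine ⟨P.proposals ⟨c.1, M ∘ c.2⟩, ?_⟩
  refine StackTransducer.Reach.mono (?_ : P.machine.Reach _ _ _)
    (show 4 * scopeWeight c (List.finRange _) + 1 + 1 ≤ _ by simp [consWeight]; omega)
  have h' := h.trans (reach_bwd_opn (n := 0) (.refl _ _))
  simpa [consText, consProposals] using reach_bwd_cls h'

/-- All proposals of the pass are computed from the stored values `M`, even after the current values
`s.2` have changed. -/
theorem reach_bwd_text (s : Bool × (Fin N → P.C)) (r : Pos ar → P.C) (M : Fin N → P.C)
    (cs : List (Σ i : Fin k, (Fin (ar i) → Fin N))) :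
    ∃ r', P.machine.Reach (4 * weight cs)
      (P.cfg (some (.bwdPass s.1 r)) i f ((text M cs).reverse ++ b) (List.ofFn s.2) [] o)
      (P.cfg (some (.bwdPass (P.round M cs s).1 r')) i (text M cs ++ f) b
        (List.ofFn (P.round M cs s).2) [] o) := by
  induction cs using List.reverseRecOn generalizing s f r with
  | nil => exact ⟨r, .refl _ _⟩
  | append_singleton cs c ih =>
    obtain ⟨r₁, h₁⟩ := reach_bwd_cons (P := P) (i := i) (f := f) (b := (text M cs).reverse ++ b)
      (o := o) s r M c
    obtain ⟨r₂, h₂⟩ := ih (f := consText c (M ∘ c.2) ++ f)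
      ((P.consProposals M c).foldl P.propose s) r₁
    refine ⟨r₂, StackTransducer.Reach.mono (?_ : P.machine.Reach _ _ _)
      (show 4 * consWeight c + 4 * weight cs ≤ _ by simp [weight]; omega)⟩
    simpa [text, round] using h₁.trans h₂

/-! ### The forward pass -/

theorem reach_fwd_var (g : Bool) (M : Fin N → P.C) (r : Pos ar → P.C) (p : Pos ar) (x : Fin N) :
    P.machine.Reach (4 * (x + 1))
      (P.cfg (some (.fwdPass g r)) i (varText p x ++ f) b (List.ofFn M) [] o)
      (P.cfg (some (.fwdPass g (Function.update r p (M x)))) i f ((varText p x).reverse ++ b)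
        (List.ofFn M) [] o) := by
  obtain ⟨u, v, hu, huv⟩ := exists_ofFn_eq M x
  have h₃ := reach_fwd_ones (P := P) (i := i) (f := .rgt p :: f) (b := .lft p :: b)
    (m := M x :: v) (t := []) (o := o) g r u
  have h₄ := reach_fwd_rewind (P := P) (i := i) (f := f) (b := (varText p x).reverse ++ b)
    (m := M x :: v) (o := o) g (Function.update r p (M x)) u.reverse
  have h₅ := h₃.trans (reach_fwd_rgt (reach_fwdRead (by simpa [varText, hu] using h₄)))
  rw [huv]
  refine StackTransducer.Reach.mono ?_
    (show 2 * u.length + (u.reverse.length + 1 + 1 + 1) + 1 ≤ _ by simp; omega)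
  simpa [varText, hu] using reach_fwd_lft h₅

/-- The alternative that the register is already correct carries the induction: later entries of the
scope do not spoil registers filled earlier. -/
theorem reach_fwd_scope (g : Bool) (M : Fin N → P.C) (r : Pos ar → P.C)
    (c : Σ i : Fin k, (Fin (ar i) → Fin N)) (js : List (Fin (ar c.1))) :
    ∃ r' : Pos ar → P.C,
      (∀ j, j ∈ js ∨ r ⟨c.1, j⟩ = M (c.2 j) → r' ⟨c.1, j⟩ = M (c.2 j)) ∧
      P.machine.Reach (4 * scopeWeight c js)
        (P.cfg (some (.fwdPass g r)) i (scopeText c js ++ f) b (List.ofFn M) [] o)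
        (P.cfg (some (.fwdPass g r')) i f ((scopeText c js).reverse ++ b) (List.ofFn M) [] o) := by
  induction js generalizing r b with
  | nil => exact ⟨r, fun j h => by simpa using h, .refl _ _⟩
  | cons j js ih =>
    obtain ⟨r', hr', h⟩ := ih (b := (varText ⟨c.1, j⟩ (c.2 j)).reverse ++ b)
      (Function.update r ⟨c.1, j⟩ (M (c.2 j)))
    refine ⟨r', fun j' hj' => hr' j' ?_, ?_⟩
    · by_cases hjj : j' = j
      · subst hjj; simp
      · rw [Function.update_of_ne (by simpa using hjj)]
        simpa [hjj] using hj'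
    · have h' := (reach_fwd_var (P := P) (i := i) (f := scopeText c js ++ f) (b := b) (o := o)
        g M r ⟨c.1, j⟩ (c.2 j)).trans h
      refine StackTransducer.Reach.mono (?_ : P.machine.Reach _ _ _)
        (show 4 * (c.2 j + 1) + 4 * scopeWeight c js ≤ _ by simp [scopeWeight]; omega)
      simpa [scopeText] using h'

theorem reach_fwd_cons (g : Bool) (M : Fin N → P.C) (r : Pos ar → P.C)
    (c : Σ i : Fin k, (Fin (ar i) → Fin N)) (v : Fin (ar c.1) → P.C) :
    ∃ r', P.machine.Reach (4 * consWeight c)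
      (P.cfg (some (.fwdPass g r)) i (consText c v ++ f) b (List.ofFn M) [] o)
      (P.cfg (some (.fwdPass g r')) i f ((consText c (M ∘ c.2)).reverse ++ b)
        (List.ofFn M) [] o) := by
  obtain ⟨r', hr', h⟩ := reach_fwd_scope (P := P) (i := i) (f := .cls ⟨c.1, v⟩ :: f)
    (b := .opn c.1 :: b) (o := o) g M r c (List.finRange _)
  refine ⟨r', StackTransducer.Reach.mono (?_ : P.machine.Reach _ _ _)
    (show 4 * scopeWeight c (List.finRange _) + 1 + 1 ≤ _ by simp [consWeight]; omega)⟩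
  have h' := h.trans (reach_fwd_cls (n := 0) (.refl _ _))
  have e : (fun j => r' ⟨c.1, j⟩) = M ∘ c.2 := funext fun j => hr' j (.inl (List.mem_finRange j))
  simp only [e] at h'
  simpa [consText] using reach_fwd_opn h'

/-- The forward pass replaces the outdated stored values `M'` by the current values `M`, as the next
backward pass requires. -/
theorem reach_fwd_text (g : Bool) (M M' : Fin N → P.C) (r : Pos ar → P.C)
    (cs : List (Σ i : Fin k, (Fin (ar i) → Fin N))) :
    ∃ r', P.machine.Reach (4 * weight cs)
      (P.cfg (some (.fwdPass g r)) i (text M' cs ++ f) b (List.ofFn M) [] o)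
      (P.cfg (some (.fwdPass g r')) i f ((text M cs).reverse ++ b) (List.ofFn M) [] o) := by
  induction cs generalizing b r with
  | nil => exact ⟨r, .refl _ _⟩
  | cons c cs ih =>
    obtain ⟨r₁, h₁⟩ := reach_fwd_cons (P := P) (i := i) (f := text M' cs ++ f) (b := b) (o := o)
      g M r c (M' ∘ c.2)
    obtain ⟨r₂, h₂⟩ := ih (b := (consText c (M ∘ c.2)).reverse ++ b) r₁
    refine ⟨r₂, StackTransducer.Reach.mono (?_ : P.machine.Reach _ _ _)
      (show 4 * consWeight c + 4 * weight cs ≤ _ by simp [weight]; omega)⟩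
    simpa [text] using h₁.trans h₂

end Propagator
namespace Propagator

variable {k : ℕ} {ar : Fin k → ℕ} {P : Propagator ar} {i : List Bool}
  {f b : List (Sym ar P.C)} {m t : List P.C} {o : List Bool} {N : ℕ}

/-! ### Reading the input -/

theorem reach_readNum (n : ℕ) :
    P.machine.Reach (n + 1) (P.cfg (some .readNum) (encodeNat n ++ i) f b m t o)
      (P.cfg (some .readCons) i f b (List.replicate n P.top ++ m) t o) := by
  induction n generalizing m with
  | zero => exact reach_readNum_false (.refl _ _)
  | succ n ih =>
    refine reach_readNum_true ?_
    simpa [replicate_append_cons, List.replicate_succ, encodeNat] using ih (m := P.top :: m)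

theorem reach_readHdr (x : ℕ) {j l : Fin k} (h : j + x = (l : ℕ)) :
    P.machine.Reach (x + 1) (P.cfg (some (.readHdr j)) (encodeNat x ++ i) f b m t o)
      (P.cfg (some (P.startVar l 0).2) i f ((P.startVar l 0).1 :: .opn l :: b) m t o) := by
  induction x generalizing j with
  | zero =>
    obtain rfl : j = l := Fin.ext h
    exact reach_readHdr_false (.refl _ _)
  | succ x ih =>
    exact reach_readHdr_true (by omega) (ih (j := ⟨j + 1, by omega⟩) (by simp; omega))

theorem reach_readVar_ones (p : Pos ar) (x : ℕ) :
    P.machine.Reach x (P.cfg (some (.readVar p)) (List.replicate x true ++ i) f b m t o)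
      (P.cfg (some (.readVar p)) i f (List.replicate x .one ++ b) m t o) := by
  induction x generalizing b with
  | zero => exact .refl _ _
  | succ x ih =>
    refine reach_readVar_true ?_
    simpa [replicate_append_cons, List.replicate_succ] using ih (b := .one :: b)

/-- Induction on the number `d` of entries still to be read. For `d = 0`, `startVar` closes the
constraint, which also covers relations of arity `0`. -/
theorem reach_readScope (c : Σ i : Fin k, (Fin (ar i) → Fin N)) (d j : ℕ) (h : j + d = ar c.1) :
    P.machine.Reach (scopeWeight c ((List.finRange _).drop j))
      (P.cfg (some (P.startVar c.1 j).2)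
        ((((List.finRange _).drop j).flatMap fun j => encodeNat (c.2 j)) ++ i) f
        ((P.startVar c.1 j).1 :: b) m t o)
      (P.cfg (some .readCons) i f
        (.cls ⟨c.1, fun _ => P.top⟩ :: ((scopeText c ((List.finRange _).drop j)).reverse ++ b))
        m t o) := by
  induction d generalizing j b with
  | zero =>
    have e : P.startVar c.1 j = (.cls ⟨c.1, fun _ => P.top⟩, .readCons) := dif_neg (by omega)
    have e' : (List.finRange (ar c.1)).drop j = [] := List.drop_eq_nil_of_le (by simp; omega)
    rw [e, e']
    exact .refl _ _
  | succ d ih =>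
    have hj : j < ar c.1 := by omega
    have e : P.startVar c.1 j = (.lft ⟨c.1, ⟨j, hj⟩⟩, .readVar ⟨c.1, ⟨j, hj⟩⟩) := dif_pos hj
    have e' : (List.finRange (ar c.1)).drop j = ⟨j, hj⟩ :: (List.finRange (ar c.1)).drop (j + 1) := by
      rw [List.drop_eq_getElem_cons (by simpa using hj)]
      simp
    rw [e, e']
    have h₁ := (reach_readVar_ones (P := P) (f := f) (m := m) (t := t) (o := o)
      (i := false :: ((((List.finRange _).drop (j + 1)).flatMap fun j => encodeNat (c.2 j)) ++ i))
      (b := .lft ⟨c.1, ⟨j, hj⟩⟩ :: b) ⟨c.1, ⟨j, hj⟩⟩ (c.2 ⟨j, hj⟩)).trans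
      (reach_readVar_false (ih (j + 1) (by omega)))
    refine StackTransducer.Reach.mono (?_ : P.machine.Reach _ _ _)
      (show c.2 ⟨j, hj⟩ + (scopeWeight c ((List.finRange _).drop (j + 1)) + 1) ≤ _ by
        simp [scopeWeight]; omega)
    simpa [scopeText, varText, encodeNat] using h₁

theorem reach_readCons (c : Σ i : Fin k, (Fin (ar i) → Fin N)) :
    P.machine.Reach (consWeight c)
      (P.cfg (some .readCons) (true :: (encodeConstraint c ++ i)) f b m t o)
      (P.cfg (some .readCons) i f ((consText c fun _ => P.top).reverse ++ b) m t o) := by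
  have h₁ := reach_readHdr (P := P) (f := f) (b := b) (m := m) (t := t) (o := o)
    (i := ((List.finRange _).flatMap fun j => encodeNat (c.2 j)) ++ i) (c.1 : ℕ)
    (j := ⟨0, Nat.zero_lt_of_lt c.1.2⟩) (l := c.1) (by simp)
  have h₂ := reach_readScope (P := P) (i := i) (f := f) (b := .opn c.1 :: b) (m := m) (t := t)
    (o := o) c (ar c.1) 0 (by simp)
  have h₃ := reach_readCons_true (Nat.zero_lt_of_lt c.1.2) (h₁.trans (by simpa using h₂))
  refine StackTransducer.Reach.mono (?_ : P.machine.Reach _ _ _)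
    (show c.1 + 1 + scopeWeight c (List.finRange _) + 1 ≤ _ by
      simp only [consWeight]; omega)
  simpa [consText, encodeConstraint, List.ofFn_eq_map, List.flatMap_map] using h₃

theorem reach_readText (cs : List (Σ i : Fin k, (Fin (ar i) → Fin N))) :
    P.machine.Reach (weight cs)
      (P.cfg (some .readCons) ((cs.flatMap fun c => true :: encodeConstraint c) ++ i) f b m t o)
      (P.cfg (some .readCons) i f ((text (fun _ => P.top) cs).reverse ++ b) m t o) := by
  induction cs generalizing b with
  | nil => exact .refl _ _
  | cons c cs ih =>
    have h := (reach_readCons (P := P) (f := f) (b := b) (m := m) (t := t) (o := o)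
      (i := (cs.flatMap fun c => true :: encodeConstraint c) ++ i) c).trans ih
    simpa [text, weight, Function.comp_def] using h

theorem reach_parse (I : Instance ar) :
    P.machine.Reach I.encode.length (P.machine.initCfg I.encode)
      (P.cfg (some (.bwdPass false fun _ => P.top)) [] []
        (text (fun _ => P.top) I.constraints).reverse
        (List.ofFn fun _ : Fin I.numVars => P.top) [] [false]) := by
  have h₀ : P.machine.initCfg I.encode = P.cfg (some .readNum) I.encode [] [] [] [] [] := by
    refine StackTransducer.Cfg.ext rfl (funext fun s => ?_) rfl
    cases s
    · exact List.map_id _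
    all_goals rfl
  have h := ((reach_readNum (P := P) (f := []) (b := []) (m := []) (t := []) (o := [])
    (i := (I.constraints.flatMap fun c => true :: encodeConstraint c) ++ [false]) I.numVars).trans
    (reach_readText I.constraints)).trans (reach_readCons_false (n := 0) (.refl _ _))
  rw [h₀, length_encode]
  refine StackTransducer.Reach.mono (?_ : P.machine.Reach _ _ _)
    (show I.numVars + 1 + weight I.constraints + 1 ≤ _ by omega)
  simpa [Instance.encode, List.ofFn_const] using h

/-! ### Writing the output -/

theorem reach_out_var (q : Fin (P.num + 1)) (p : Pos ar) (x : ℕ) :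
    P.machine.Reach (x + 2) (P.cfg (some (.outPass q)) i f ((varText p x).reverse ++ b) m t o)
      (P.cfg (some (.outPass q)) i f b m t (encodeNat x ++ o)) := by
  have h : ∀ o, P.machine.Reach (x + 1)
      (P.cfg (some (.outPass q)) i f (List.replicate x .one ++ .lft p :: b) m t o)
      (P.cfg (some (.outPass q)) i f b m t (List.replicate x true ++ o)) := by
    induction x with
    | zero => exact fun o => reach_out_lft (.refl _ _)
    | succ x ih =>
      intro o
      refine reach_out_one ?_
      simpa [replicate_append_cons, List.replicate_succ] using ih (true :: o)
  simpa [varText, encodeNat] using reach_out_rgt (h (false :: o))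

theorem reach_out_scope (q : Fin (P.num + 1)) (c : Σ i : Fin k, (Fin (ar i) → Fin N))
    (js : List (Fin (ar c.1))) :
    P.machine.Reach (2 * scopeWeight c js)
      (P.cfg (some (.outPass q)) i f ((scopeText c js).reverse ++ b) m t o)
      (P.cfg (some (.outPass q)) i f b m t ((js.flatMap fun j => encodeNat (c.2 j)) ++ o)) := by
  induction js using List.reverseRecOn generalizing o with
  | nil => exact .refl _ _
  | append_singleton js j ih =>
    have h := (reach_out_var (P := P) (i := i) (f := f) (b := (scopeText c js).reverse ++ b)
      (m := m) (t := t) (o := o) q ⟨c.1, j⟩ (c.2 j)).trans ih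
    refine StackTransducer.Reach.mono (?_ : P.machine.Reach _ _ _)
      (show c.2 j + 2 + 2 * scopeWeight c js ≤ _ by simp [scopeWeight]; omega)
    simpa [scopeText] using h

/-- One more `true` than the number `x` is written: the leftmost one announces the constraint. -/
theorem reach_outHdr (x : ℕ) (hx : x < P.num + 1) :
    P.machine.Reach (x + 1) (P.cfg (some (.outHdr ⟨x, hx⟩)) [] f b m t o)
      (P.cfg (some (.outPass 0)) [] f b m t (true :: (List.replicate x true ++ o))) := by
  induction x generalizing o with
  | zero => exact reach_outHdr_zero (.refl _ _)
  | succ x ih =>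
    refine reach_outHdr_succ ?_
    simpa [replicate_append_cons, List.replicate_succ] using ih (by omega) (o := true :: o)

/-- The constraint of the output which comes from the constraint `c`. -/
noncomputable def outputCons (P : Propagator ar) (M : Fin N → P.C)
    (c : Σ i : Fin k, (Fin (ar i) → Fin N)) :
    Σ q : Fin P.num, (Fin (ar (P.numbering.symm q).1) → Fin N) :=
  ⟨P.numbering ⟨c.1, M ∘ c.2⟩, fun j => c.2 (Fin.cast (by simp) j)⟩

/-- The instance that is put out if the algorithm ends with the values `M`. -/
noncomputable def output (P : Propagator ar) (I : Instance ar) (M : Fin I.numVars → P.C) :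
    Instance fun q : Fin P.num => ar (P.numbering.symm q).1 :=
  ⟨I.numVars, I.constraints.map (P.outputCons M)⟩

theorem encodeConstraint_outputCons (M : Fin N → P.C) (c : Σ i : Fin k, (Fin (ar i) → Fin N)) :
    encodeConstraint (P.outputCons M c) = encodeNat (P.numbering ⟨c.1, M ∘ c.2⟩) ++
      (List.finRange _).flatMap fun j => encodeNat (c.2 j) := by
  rw [encodeConstraint, outputCons]
  simp only
  rw [← List.ofFn_congr (by simp) c.2, List.ofFn_eq_map, List.flatMap_map]

/-- The symbol `cls`, met first, supplies the index of the new relation, which is kept in the state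
until the scope has been written to its right. The factor `P.num + 3` pays for writing this index in
unary. -/
theorem reach_out_cons (q : Fin (P.num + 1)) (M : Fin N → P.C)
    (c : Σ i : Fin k, (Fin (ar i) → Fin N)) :
    P.machine.Reach ((P.num + 3) * consWeight c)
      (P.cfg (some (.outPass q)) [] f ((consText c (M ∘ c.2)).reverse ++ b) m t o)
      (P.cfg (some (.outPass 0)) [] f b m t
        (true :: (encodeConstraint (P.outputCons M c) ++ o))) := by
  have h₁ := reach_out_scope (P := P) (i := []) (f := f) (b := .opn c.1 :: b) (m := m) (t := t)
    (o := o) (P.numbering ⟨c.1, M ∘ c.2⟩).castSucc c (List.finRange _)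
  have h₂ := h₁.trans (reach_out_opn (reach_outHdr _ (P.numbering ⟨c.1, M ∘ c.2⟩).castSucc.2))
  refine StackTransducer.Reach.mono (?_ : P.machine.Reach _ _ _)
    (show 2 * scopeWeight c (List.finRange _) +
      ((P.numbering ⟨c.1, M ∘ c.2⟩).castSucc + 1 + 1) + 1 ≤ _ by
        have h₃ := (P.numbering ⟨c.1, M ∘ c.2⟩).castSucc.2
        have h₄ : scopeWeight c (List.finRange _) + 2 ≤ consWeight c := by
          simp [consWeight]; omega
        nlinarith)
  simpa [consText, encodeConstraint_outputCons, encodeNat] using reach_out_cls h₂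

theorem reach_out_text (q : Fin (P.num + 1)) (M : Fin N → P.C)
    (cs : List (Σ i : Fin k, (Fin (ar i) → Fin N))) :
    ∃ q', P.machine.Reach ((P.num + 3) * weight cs)
      (P.cfg (some (.outPass q)) [] f ((text M cs).reverse ++ b) m t o)
      (P.cfg (some (.outPass q')) [] f b m t
        (((cs.map (P.outputCons M)).flatMap fun c => true :: encodeConstraint c) ++ o)) := by
  induction cs using List.reverseRecOn generalizing o q with
  | nil => exact ⟨q, .refl _ _⟩
  | append_singleton cs c ih =>
    obtain ⟨q', h⟩ := ih (o := true :: (encodeConstraint (P.outputCons M c) ++ o)) 0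
    have h' := (reach_out_cons (P := P) (f := f) (b := (text M cs).reverse ++ b)
      (m := m) (t := t) (o := o) q M c).trans h
    refine ⟨q', StackTransducer.Reach.mono (?_ : P.machine.Reach _ _ _)
      (show (P.num + 3) * consWeight c + (P.num + 3) * weight cs ≤ _ by
        simp [weight, mul_add]; omega)⟩
    simpa [text] using h'

theorem reach_outNum (m : List P.C) :
    P.machine.Reach (m.length + 1) (P.cfg (some .outNum) i f b m t o)
      (P.cfg none i f b [] t (List.replicate m.length true ++ o)) := by
  induction m generalizing o with
  | nil => exact reach_outNum_nil (.refl _ _)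
  | cons a m ih =>
    refine reach_outNum_cons ?_
    simpa [replicate_append_cons, List.replicate_succ] using ih (o := true :: o)

theorem reach_output (I : Instance ar) (M : Fin I.numVars → P.C) :
    P.machine.Reach ((P.num + 4) * I.encode.length)
      (P.cfg (some (.outPass 0)) [] [] (text M I.constraints).reverse (List.ofFn M) [] [false])
      (P.machine.doneCfg (P.output I M).encode) := by
  have h₀ : P.machine.doneCfg (P.output I M).encode =
      P.cfg none [] [] [] [] [] (P.output I M).encode := by
    refine StackTransducer.Cfg.ext rfl (funext fun s => ?_) rfl
    cases s <;> rfl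
  obtain ⟨q, h⟩ := reach_out_text (P := P) (f := []) (b := []) (m := List.ofFn M) (t := [])
    (o := [false]) 0 M I.constraints
  have h' := h.trans (reach_out_nil (reach_outNum _))
  rw [h₀]
  refine StackTransducer.Reach.mono (?_ : P.machine.Reach _ _ _)
    (show (P.num + 3) * weight I.constraints + ((List.ofFn M).length + 1 + 1) ≤ _ by
      rw [length_encode]; simp only [List.length_ofFn]; nlinarith)
  simpa [output, Instance.encode, encodeNat] using h'

/-! ### The main loop -/

/-- If no proposal was accepted, the values never changed, so each proposal was in fact compared
with the initial values. -/
theorem foldl_propose_eq_false (ws : List (Fin N × P.C)) (s : Bool × (Fin N → P.C))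
    (h : (ws.foldl P.propose s).1 = false) :
    s.1 = false ∧ (ws.foldl P.propose s).2 = s.2 ∧
      ∀ w ∈ ws, P.better w.2 (s.2 w.1) = false := by
  induction ws generalizing s with
  | nil => exact ⟨h, rfl, by simp⟩
  | cons w ws ih =>
    obtain ⟨h₁, h₂, h₃⟩ := ih _ h
    simp only [propose, Bool.or_eq_false_iff] at h₁
    have e : P.propose s w = s := by
      simp [propose, h₁.2]
    rw [e] at h₂ h₃
    refine ⟨h₁.1, by rw [List.foldl_cons, e, h₂], ?_⟩
    simpa [h₁.2] using h₃

theorem foldl_propose_induction (I : (Fin N → P.C) → Prop) (ws : List (Fin N × P.C))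
    (h : ∀ w ∈ ws, ∀ M, I M → P.better w.2 (M w.1) → I (Function.update M w.1 w.2))
    (s : Bool × (Fin N → P.C)) (hs : I s.2) : I (ws.foldl P.propose s).2 := by
  induction ws generalizing s with
  | nil => exact hs
  | cons w ws ih =>
    refine ih (fun w' hw' => h w' (by simp [hw'])) _ ?_
    simp only [propose]
    split
    · exact h w (by simp) _ hs ‹_›
    · exact hs

theorem sum_update_lt {rank : P.C → ℕ} {M : Fin N → P.C} {x : Fin N} {a : P.C}
    (h : rank a < rank (M x)) : ∑ y, rank (Function.update M x a y) < ∑ y, rank (M y) := by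
  refine Finset.sum_lt_sum (fun y _ => ?_) ⟨x, Finset.mem_univ _, by simpa using h⟩
  by_cases hy : y = x
  · subst hy; simpa using h.le
  · simp [hy]

/-- Rejected proposals change nothing, the first accepted one lowers the sum of ranks, and no later
one can raise it. -/
theorem foldl_propose_sum_lt {rank : P.C → ℕ} (hrank : ∀ a b, P.better a b → rank a < rank b)
    (ws : List (Fin N × P.C)) (M : Fin N → P.C) (h : (ws.foldl P.propose (false, M)).1 = true) :
    ∑ y, rank ((ws.foldl P.propose (false, M)).2 y) < ∑ y, rank (M y) := by
  induction ws with
  | nil => simp at h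
  | cons w ws ih =>
    by_cases hw : P.better w.2 (M w.1) = true
    · refine lt_of_le_of_lt (b := ∑ y, rank (Function.update M w.1 w.2 y)) ?_
        (sum_update_lt (hrank _ _ hw))
      refine foldl_propose_induction
        (fun M' => ∑ y, rank (M' y) ≤ ∑ y, rank (Function.update M w.1 w.2 y)) ws
        (fun w' _ M' hM' hb => ((sum_update_lt (hrank _ _ hb)).le.trans hM')) _ ?_
      simp [propose, hw]
    · have e : P.propose (false, M) w = (false, M) := by
        simp [propose, hw]
      rw [List.foldl_cons, e] at h ⊢
      exact ih h

theorem mem_consProposals {M : Fin N → P.C} {c : Σ i : Fin k, (Fin (ar i) → Fin N)}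
    {w : Fin N × P.C} :
    w ∈ P.consProposals M c ↔ ∃ j, (c.2 j, P.upd c.1 (M ∘ c.2) j) = w := by
  simp [consProposals]

/-- A round with an accepted proposal lowers the sum of ranks, so there are at most `n + 1` rounds,
each consisting of two passes and two changes of direction or mode. In `hI`, `M₀` holds the stored
values behind a proposal and `M` the values current when it is accepted; these may differ within a
round. -/
theorem reach_loop {rank : P.C → ℕ} (hrank : ∀ a b, P.better a b → rank a < rank b)
    (cs : List (Σ i : Fin k, (Fin (ar i) → Fin N))) (I : (Fin N → P.C) → Prop)
    (hI : ∀ M₀ M, I M₀ → I M → ∀ c ∈ cs, ∀ j, P.better (P.upd c.1 (M₀ ∘ c.2) j) (M (c.2 j)) →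
      I (Function.update M (c.2 j) (P.upd c.1 (M₀ ∘ c.2) j)))
    (n : ℕ) (M : Fin N → P.C) (hM : I M) (hn : ∑ y, rank (M y) ≤ n) (r : Pos ar → P.C) :
    ∃ M', I M' ∧ (∀ c ∈ cs, ∀ j, P.better (P.upd c.1 (M' ∘ c.2) j) (M' (c.2 j)) = false) ∧
      P.machine.Reach ((n + 1) * (8 * weight cs + 2))
        (P.cfg (some (.bwdPass false r)) i [] (text M cs).reverse (List.ofFn M) [] o)
        (P.cfg (some (.outPass 0)) i [] (text M' cs).reverse (List.ofFn M') [] o) := by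
  induction n using Nat.strong_induction_on generalizing M r with
  | _ n ih =>
  obtain ⟨r₁, h₁⟩ := reach_bwd_text (P := P) (i := i) (f := []) (b := []) (o := o) (false, M) r M cs
  obtain ⟨r₂, h₂⟩ := reach_fwd_text (P := P) (i := i) (f := []) (b := []) (o := o)
    (P.round M cs (false, M)).1 (P.round M cs (false, M)).2 M r₁ cs
  simp only [List.append_nil] at h₁ h₂
  have h₃ := h₁.trans (reach_bwd_nil h₂)
  have hI' : I (P.round M cs (false, M)).2 := by
    refine foldl_propose_induction I _ (fun w hw M' hM' hb => ?_) _ hM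
    simp only [List.mem_flatMap, List.mem_reverse, mem_consProposals] at hw
    obtain ⟨c, hc, j, rfl⟩ := hw
    exact hI M M' hM hM' c hc j hb
  cases hr : (P.round M cs (false, M)).1 with
  | false =>
    -- In a quiet round the stored and the current values are both `M`, so rejection of all
    -- proposals is the required stability of `M`.
    obtain ⟨-, h₄, h₅⟩ := foldl_propose_eq_false _ _ hr
    change (P.round M cs (false, M)).2 = M at h₄
    refine ⟨M, hM, fun c hc j => h₅ (c.2 j, P.upd c.1 (M ∘ c.2) j) ?_, ?_⟩
    · simp only [List.mem_flatMap, List.mem_reverse, mem_consProposals]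
      exact ⟨c, hc, j, rfl⟩
    · rw [hr, h₄] at h₃
      refine StackTransducer.Reach.mono (h₃.trans (reach_fwd_nil_false (n := 0) (.refl _ _))) ?_
      nlinarith
  | true =>
    have h₄ : ∑ y, rank ((P.round M cs (false, M)).2 y) < ∑ y, rank (M y) :=
      foldl_propose_sum_lt hrank _ M hr
    obtain ⟨M', hM', hs, h₅⟩ := ih (n - 1) (by omega) _ hI' (by omega) r₂
    refine ⟨M', hM', hs, ?_⟩
    rw [hr] at h₃
    refine StackTransducer.Reach.mono (h₃.trans (reach_fwd_nil_true h₅)) ?_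
    obtain ⟨n, rfl⟩ : ∃ n', n = n' + 1 := ⟨n - 1, by omega⟩
    simp only [Nat.add_sub_cancel]
    nlinarith

end Propagator

/-- A decision problem for instances is in `P` if some propagation algorithm reduces it to a problem
in `P`. Here `Inv` is an invariant of the algorithm. -/
theorem InP.of_propagator {k : ℕ} {ar : Fin k → ℕ} (P : Propagator ar) (rank : P.C → ℕ)
    (hrank : ∀ a b, P.better a b → rank a < rank b) {p : Instance ar → Prop}
    {p' : (Instance fun q : Fin P.num => ar (P.numbering.symm q).1) → Prop}
    (Inv : ∀ I : Instance ar, (Fin I.numVars → P.C) → Prop) (htop : ∀ I, Inv I fun _ => P.top)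
    (hstep : ∀ (I : Instance ar) (M₀ M : Fin I.numVars → P.C), Inv I M₀ → Inv I M →
      ∀ c ∈ I.constraints, ∀ j, P.better (P.upd c.1 (M₀ ∘ c.2) j) (M (c.2 j)) →
        Inv I (Function.update M (c.2 j) (P.upd c.1 (M₀ ∘ c.2) j)))
    (hfinal : ∀ (I : Instance ar) (M : Fin I.numVars → P.C), Inv I M →
      (∀ c ∈ I.constraints, ∀ j, P.better (P.upd c.1 (M ∘ c.2) j) (M (c.2 j)) = false) →
        (p I ↔ p' (P.output I M)))
    (h : InP Instance.encode p') : InP Instance.encode p := by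
  classical
  obtain ⟨H, hH⟩ : ∃ H, ∀ a, rank a ≤ H :=
    ⟨∑ a, rank a, fun a => Finset.single_le_sum (f := rank) (by simp) (Finset.mem_univ a)⟩
  have key : ∀ I : Instance ar, ∃ M : Fin I.numVars → P.C, (p I ↔ p' (P.output I M)) ∧
      P.machine.Reach (I.encode.length + (I.encode.length * H + 1) * (8 * I.encode.length + 2) +
        (P.num + 4) * I.encode.length) (P.machine.initCfg I.encode)
        (P.machine.doneCfg (P.output I M).encode) := by
    intro I
    -- The variables are counted in unary in the code, so its length bounds their number and the
    -- initial sum of ranks is linear in it.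
    have hsum : ∑ _ : Fin I.numVars, rank P.top ≤ I.encode.length * H := by
      simp only [Finset.sum_const, Finset.card_univ, Fintype.card_fin, smul_eq_mul]
      exact Nat.mul_le_mul (by rw [Propagator.length_encode]; omega) (hH _)
    obtain ⟨M, hM, hM', hr⟩ := Propagator.reach_loop (i := []) (o := [false]) hrank I.constraints
      (Inv I) (hstep I) _ _ (htop I) hsum fun _ => P.top
    refine ⟨M, hfinal I M hM hM', ?_⟩
    refine ((Propagator.reach_parse I).trans (hr.mono ?_)).trans (Propagator.reach_output I M)
    refine Nat.mul_le_mul_left _ ?_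
    rw [Propagator.length_encode]
    omega
  choose M hM hM' using key
  refine InP.of_stackTransducer h (fun I => P.output I (M I)) hM P.machine
    (.X + (.X * .C H + 1) * (.C 8 * .X + .C 2) + .C (P.num + 4) * .X) fun I => ?_
  simpa only [Polynomial.eval_add, Polynomial.eval_mul, Polynomial.eval_X, Polynomial.eval_C,
    Polynomial.eval_one] using hM' I

open FirstOrder FirstOrder.Language.Structure

section Join

variable {L : FirstOrder.Language.{u, v}} {A : Type w} [L.Structure A]

/-! ### The order of the semilattice quotient -/

/-- The block of `x` lies below the block of `y`. -/
def JoinLE (t : L.Term (Fin 2)) (x y : A) : Prop := join t y x = y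

variable {t : L.Term (Fin 2)}

theorem join_right_comm (ht : IsPseudopartition A t) (x y z : A) :
    join t (join t x y) z = join t (join t x z) y := by
  rw [ht.p2, ht.p3, ht.p2]

theorem JoinLE.refl (ht : IsPseudopartition A t) (x : A) : JoinLE t x x := ht.p1 x

theorem JoinLE.trans (ht : IsPseudopartition A t) {x y z : A} (h : JoinLE t x y)
    (h' : JoinLE t y z) : JoinLE t x z := by
  unfold JoinLE at *
  rw [← h', ht.p2, h]

theorem JoinLE.join (ht : IsPseudopartition A t) {x y z : A} (h : JoinLE t x z)
    (h' : JoinLE t y z) : JoinLE t (join t x y) z := by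
  unfold JoinLE at *
  rw [← ht.p2, h, h']

/-- Joining from the right depends only on the block. -/
theorem join_eq_join (ht : IsPseudopartition A t) (x : A) {y z : A} (h : JoinLE t y z)
    (h' : JoinLE t z y) : CSPAlg.join t x y = CSPAlg.join t x z := by
  unfold JoinLE at *
  rw [← h', ht.p3, h]

theorem foldl_join_right_comm (ht : IsPseudopartition A t) (l : List A) (x y : A) :
    join t (l.foldl (join t) x) y = l.foldl (join t) (join t x y) := by
  induction l generalizing x with
  | nil => rfl
  | cons z l ih => rw [List.foldl_cons, ih, List.foldl_cons, join_right_comm ht]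

theorem joinLE_foldl_self (ht : IsPseudopartition A t) (l : List A) (x : A) :
    JoinLE t x (l.foldl (join t) x) := by
  rw [JoinLE, foldl_join_right_comm ht, ht.p1]

theorem joinLE_foldl (ht : IsPseudopartition A t) {l : List A} {x y : A} (h : y ∈ l) :
    JoinLE t y (l.foldl (join t) x) := by
  induction l generalizing x with
  | nil => simp at h
  | cons z l ih =>
    rcases List.mem_cons.1 h with rfl | h
    · rw [List.foldl_cons, JoinLE, foldl_join_right_comm ht, ht.p2, ht.p1]
    · exact ih h

/-- The join of all elements, in any order, lies above each of them. -/
theorem exists_joinLE_top [Finite A] [Nonempty A] (ht : IsPseudopartition A t) :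
    ∃ a : A, ∀ x, JoinLE t x a := by
  have := Fintype.ofFinite A
  exact ⟨_, fun x => joinLE_foldl ht (l := Finset.univ.toList) (x := Classical.arbitrary A) (by simp)⟩

theorem term_realize_mem {R : FinitaryRel A} (hR : R ∈ Inv L A) {α : Type*} (s : L.Term α)
    (x : α → Fin R.arity → A) (hx : ∀ a, x a ∈ R.rel) :
    (fun i => s.realize fun a => x a i) ∈ R.rel := by
  induction s with
  | var a => exact hx a
  | func f ts ih => exact hR _ f _ ih

theorem join_mem {R : FinitaryRel A} (hR : R ∈ Inv L A) (t : L.Term (Fin 2))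
    {x y : Fin R.arity → A} (hx : x ∈ R.rel) (hy : y ∈ R.rel) :
    (fun i => join t (x i) (y i)) ∈ R.rel := by
  have h := term_realize_mem hR t ![x, y] (by simp [Fin.forall_fin_two, hx, hy])
  convert h using 3 with i
  refine congrArg (fun z => t.realize z) (funext fun a => ?_)
  fin_cases a <;> rfl

/-- A nonempty subset of a finite invariant relation that is bounded by `m` has a join in the
relation that is bounded by `m`. -/
theorem exists_join_mem [Finite A] (ht : IsPseudopartition A t) {R : FinitaryRel A}
    (hR : R ∈ Inv L A) (m : Fin R.arity → A) (hm : ∃ x ∈ R.rel, ∀ j, JoinLE t (x j) (m j)) :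
    ∃ y ∈ R.rel, (∀ j, JoinLE t (y j) (m j)) ∧
      ∀ x ∈ R.rel, (∀ j, JoinLE t (x j) (m j)) → ∀ j, JoinLE t (x j) (y j) := by
  obtain ⟨x₀, hx₀, hx₀m⟩ := hm
  have hfin : {x | x ∈ R.rel ∧ ∀ j, JoinLE t (x j) (m j)}.Finite := Set.toFinite _
  have key : ∀ l : List (Fin R.arity → A), (∀ x ∈ l, x ∈ R.rel ∧ ∀ j, JoinLE t (x j) (m j)) →
      ∃ y ∈ R.rel, (∀ j, JoinLE t (y j) (m j)) ∧ ∀ x ∈ l, ∀ j, JoinLE t (x j) (y j) := by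
    intro l
    induction l with
    | nil => exact fun _ => ⟨x₀, hx₀, hx₀m, by simp⟩
    | cons z l ih =>
      intro h
      obtain ⟨y, hy, hym, hly⟩ := ih fun x hx => h x (by simp [hx])
      obtain ⟨hz, hzm⟩ := h z (by simp)
      refine ⟨_, join_mem hR t hy hz, fun j => (hym j).join ht (hzm j), fun x hx j => ?_⟩
      rcases List.mem_cons.1 hx with rfl | hx
      · exact joinLE_foldl ht (l := [x j]) (x := y j) (by simp)
      · exact (hly x hx j).trans ht (joinLE_foldl_self ht [z j] (y j))
  obtain ⟨y, hy, hym, hly⟩ := key hfin.toFinset.toList (by simp)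
  exact ⟨y, hy, hym, fun x hx hxm => hly x (by simp [hx, hxm])⟩

open Classical in
/-- The join of all tuples of `R` that are bounded by `m`, if there are any. -/
noncomputable def boundedJoin (t : L.Term (Fin 2)) (R : FinitaryRel A) (m : Fin R.arity → A) :
    Fin R.arity → A :=
  if h : ∃ y ∈ R.rel, (∀ j, JoinLE t (y j) (m j)) ∧
      ∀ x ∈ R.rel, (∀ j, JoinLE t (x j) (m j)) → ∀ j, JoinLE t (x j) (y j) then h.choose
  else m

theorem boundedJoin_spec [Finite A] (ht : IsPseudopartition A t) {R : FinitaryRel A}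
    (hR : R ∈ Inv L A) {m x : Fin R.arity → A} (hx : x ∈ R.rel) (hm : ∀ j, JoinLE t (x j) (m j)) :
    boundedJoin t R m ∈ R.rel ∧ (∀ j, JoinLE t (boundedJoin t R m j) (m j)) ∧
      ∀ j, JoinLE t (x j) (boundedJoin t R m j) := by
  have h := exists_join_mem ht hR m ⟨x, hx, hm⟩
  rw [boundedJoin, dif_pos h]
  exact ⟨h.choose_spec.1, h.choose_spec.2.1, h.choose_spec.2.2 x hx hm⟩

/-! ### Solutions in blocks -/

/-- If `M` is an upper bound of the solution `g`, and the propagation cannot lower `M`, then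
`g ∨ M` is a solution in the blocks of `M`. -/
theorem join_solution [Finite A] (ht : IsPseudopartition A t) {R : FinitaryRel A}
    (hR : R ∈ Inv L A) {m x : Fin R.arity → A} (hx : x ∈ R.rel) (hm : ∀ j, JoinLE t (x j) (m j))
    (hs : ∀ j, JoinLE t (boundedJoin t R m j) (m j) → JoinLE t (m j) (boundedJoin t R m j)) :
    (fun j => join t (x j) (m j)) ∈ R.rel := by
  obtain ⟨h₁, h₂, -⟩ := boundedJoin_spec ht hR hx hm
  convert join_mem hR t hx h₁ using 2 with j
  exact join_eq_join ht _ (hs j (h₂ j)) (h₂ j)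

/-- This places the modified solution `g ∨ M` in the blocks of `M`. -/
theorem sigmaRel_join (ht : IsPseudopartition A t) {x a : A} (h : JoinLE t x a) :
    SigmaRel t (join t x a) a := by
  refine ⟨by rw [ht.p2, ht.p1], ?_⟩
  rw [← ht.p2, h, ht.p1]

/-- The size of the down-set serves as the rank of a bound: `b` lies in its own down-set but not in
that of `a`. -/
theorem card_joinLE_lt [Finite A] (ht : IsPseudopartition A t) {a b : A} (h : JoinLE t a b)
    (h' : ¬ JoinLE t b a) : {x | JoinLE t x a}.ncard < {x | JoinLE t x b}.ncard := by
  refine Set.ncard_lt_ncard ⟨fun x hx => JoinLE.trans ht hx h, fun hs => h' ?_⟩ (Set.toFinite _)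
  exact hs (JoinLE.refl ht b)

/-- The product of the blocks. -/
abbrev BlockProd (hA : IsIdempotent L A) (ht : IsPseudopartition A t) : Type w :=
  ∀ a : A, block hA ht a

/-- The relation on the product of the blocks which restricts the components `a j` to `R`. -/
def blockRel (hA : IsIdempotent L A) (ht : IsPseudopartition A t) (R : FinitaryRel A)
    (a : Fin R.arity → A) : FinitaryRel (BlockProd hA ht) :=
  ⟨R.arity, {x | (fun j => (x j (a j) : A)) ∈ R.rel}⟩

/-- Operations of the product act coordinatewise, so reading the coordinates `a j` turns invariance
into that of `R`. -/
theorem blockRel_mem_inv (hA : IsIdempotent L A) (ht : IsPseudopartition A t) {R : FinitaryRel A}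
    (hR : R ∈ Inv L A) (a : Fin R.arity → A) :
    blockRel hA ht R a ∈ Inv L (BlockProd hA ht) :=
  fun n f x hx => hR n f (fun l j => (x l j (a j) : A)) hx

end Join

end CSPAlg

/-! ### Reduction to the product of the blocks -/

open CSPAlg in
theorem theorem4p1 {L : FirstOrder.Language.{u, v}} [L.IsAlgebraic]
    {A : Type w} [L.Structure A] [Nonempty A] [Finite A]
    (hA : CSPAlg.IsIdempotent L A)
    (t : L.Term (Fin 2)) (ht : CSPAlg.IsPseudopartition A t)
    (V : CSPAlg.Variety.{u, v, w} L) (hV : V.IsTractable)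
    (hblock : ∀ a : A, V.Mem (CSPAlg.block hA ht a)) :
    CSPAlg.IsTractableAlgebra L A := by
  classical
  intro k Δ hΔ
  -- Machine alphabets live in `Type` while `A` lives in `Type w`, so the bounds are coded by `Fin
  -- N`.
  obtain ⟨N, ⟨e⟩⟩ := Finite.exists_equiv_fin A
  obtain ⟨top, htop⟩ := exists_joinLE_top ht
  let P : Propagator fun i => (Δ i).arity :=
    { C := Fin N
      top := e top
      upd := fun i v j => e (boundedJoin t (Δ i) (e.symm ∘ v) j)
      better := fun a b => decide (JoinLE t (e.symm a) (e.symm b) ∧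
        ¬ JoinLE t (e.symm b) (e.symm a)) }
  have hB : V.Mem (BlockProd hA ht) := V.pi_mem _ hblock
  let Δ' : Fin P.num → FinitaryRel (BlockProd hA ht) := fun q =>
    blockRel hA ht (Δ (P.numbering.symm q).1) (e.symm ∘ (P.numbering.symm q).2)
  have hΔ' : InP Instance.encode (Instance.Solvable Δ') :=
    hV (BlockProd hA ht) hB P.num Δ' fun q => blockRel_mem_inv hA ht (hΔ _) _
  -- The invariant says that `M` is an upper bound of every solution.
  refine InP.of_propagator P (fun a => {x | JoinLE t x (e.symm a)}.ncard) ?_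
    (fun I M => ∀ g : Fin I.numVars → A,
      (∀ c ∈ I.constraints, (fun j => g (c.2 j)) ∈ (Δ c.1).rel) →
        ∀ x, JoinLE t (g x) (e.symm (M x))) ?_ ?_ ?_ hΔ'
  · intro a b h
    obtain ⟨h, h'⟩ := of_decide_eq_true h
    exact card_joinLE_lt ht h h'
  · intro I g _ x
    simpa [P] using htop (g x)
  · intro I M₀ M hM₀ hM c hc j _ g hg x
    by_cases hx : x = c.2 j
    · subst hx
      -- On this scope `g` is a tuple of the relation below `M₀`, hence one of the tuples lying
      -- below the proposed join.
      simpa [P] using (boundedJoin_spec ht (hΔ c.1) (m := e.symm ∘ M₀ ∘ c.2) (hg c hc)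
        fun j => hM₀ g hg _).2.2 j
    · simpa [hx] using hM g hg x
  · intro I M hM hs
    have hrel : ∀ (h : Fin I.numVars → BlockProd hA ht) (c : Σ i, (Fin (Δ i).arity → Fin I.numVars)),
        ((fun j => h ((P.outputCons M c).2 j)) ∈ (Δ' (P.outputCons M c).1).rel) ↔
          (fun j => (h (c.2 j) (e.symm (M (c.2 j))) : A)) ∈ (Δ c.1).rel := by
      intro h c
      -- The index `P.numbering.symm (P.numbering _)` simplifies only propositionally and the arity
      -- depends on it; a general `q` allows substitution.
      have key : ∀ (q : ScopeVal (fun i => (Δ i).arity) P.C) (hq : q = ⟨c.1, M ∘ c.2⟩)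
          (hq' : (Δ q.1).arity = (Δ c.1).arity),
          ((fun j => h (c.2 (Fin.cast hq' j))) ∈
            (blockRel hA ht (Δ q.1) (e.symm ∘ q.2)).rel) ↔
          (fun j => (h (c.2 j) (e.symm (M (c.2 j))) : A)) ∈ (Δ c.1).rel := by
        rintro _ rfl _
        exact Iff.rfl
      exact key _ (P.numbering.symm_apply_apply _) _
    constructor
    · rintro ⟨g, hg⟩
      have hgM := hM g hg
      -- Only the coordinate `M x` is ever read, so the others are arbitrary.
      let g' : Fin I.numVars → BlockProd hA ht := fun x a => if h : a = e.symm (M x) then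
        ⟨join t (g x) (e.symm (M x)), by subst h; exact sigmaRel_join ht (hgM x)⟩
        else Classical.arbitrary _
      refine ⟨g', ?_⟩
      intro c' hc'
      obtain ⟨c, hc, rfl⟩ := List.mem_map.1 hc'
      refine (hrel g' c).2 ?_
      have h := join_solution ht (hΔ c.1) (m := e.symm ∘ M ∘ c.2) (hg c hc)
        (fun j => hgM _) fun j hj => ?_
      · simpa [g'] using h
      -- Stability excludes that the join lies strictly below `M`; as it lies below, it is
      -- equivalent to `M`.
      · by_contra hj'
        have := hs c hc j
        simp [P] at this
        exact hj' (this hj)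
    · rintro ⟨h, hh⟩
      refine ⟨fun x => h x (e.symm (M x)), fun c hc => ?_⟩
      exact (hrel h c).1 (hh _ (List.mem_map_of_mem hc))
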